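/- Let $N=2^n$ and $[N]=\{0,1\}^n$. For a nonempty subset $S\subseteq[N]$ and $f:[N]\to\{0,1\}$, let $|S\rangle=|S|^{-1/2}\sum_{x\in S}|x\rangle$ and $|S,f\rangle=|S|^{-1/2}\sum_{x\in S}(-1)^{f(x)}|x\rangle$ in $\mathbb C^{N}$. For $1\le m\le N$ and $b\in[-1,1]$ let $$\rho_{n,t,m,b}=\mathop{\mathbb E}_{S,f}\,\big(|S,f\rangle\langle S,f|\big)^{\otimes t},$$ where $S$ is a uniformly random $m$-element subset of $[N]$ and, independently, the values $f(x)$, $x\in[N]$, are i.i.d. with $\mathbb P[f(x)=1]=\frac{1+b}{2}$. Let $\mathrm{TD}(A,B)=\frac12\|A-B\|_1$ be the trace distance, where $\|\cdot\|_1$ is the trace norm. There is an absolute constant $C>0$ such that for all sequences $t=t(n)$, $m=m(n)$ of natural numbers and $b=b(n)\in[-1,1]$ with $t=O(n^k)$ for some $k$, $m=\omega(n^k)$ for every $k$, and $m=o(2^n)$, for all sufficiently large $n$: $$\mathrm{TD}\Big(\rho_{n,t,m,b},\ \mathop{\mathbb E}_{|\phi\rangle\sim\mathrm{Haar}([N])}\big(|\phi\rangle\langle\phi|\big)^{\otimes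 t}\Big)\ \le\ C\,\frac{t\,m\,b^2}{N}+C\,\frac{t^2}{m},$$ where $|\phi\rangle$ is a Haar-random (uniformly distributed) unit vector of $\mathbb C^N$. Moreover this family interpolates between subset states and unbiased subset-phase states: for all $n,t\ge 0$ and $1\le m\le N$, $\rho_{n,t,m,1}=\rho_{n,t,m,-1}=\mathbb E_S(|S\rangle\langle S|)^{\otimes t}$, and $\rho_{n,t,m,0}=\mathbb E_{S,f}(|S,f\rangle\langle S,f|)^{\otimes t}$ with $f$ uniformly distributed over all functions $[N]\to\{0,1\}$. -/

import Mathlib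

open Filter Asymptotics MeasureTheory

noncomputable section

/-- The Hilbert space with orthonormal computational basis indexed by `ι`. -/
abbrev StateSpace (ι : Type) [Fintype ι] : Type := EuclideanSpace ℂ ι

/-- The subset state `|S⟩ = |S|^{-1/2} ∑_{x ∈ S} |x⟩`. -/
def subsetState {ι : Type} [Fintype ι] [DecidableEq ι] (S : Finset ι) : StateSpace ι :=
  WithLp.toLp 2 fun x => if x ∈ S then ((1 / Real.sqrt (S.card : ℝ) : ℝ) : ℂ) else 0

/-- The subset-phase state `|S, f⟩ = |S|^{-1/2} ∑_{x ∈ S} (-1)^{f(x)} |x⟩`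
(`true` stands for `1` and `false` for `0`). -/
def subsetPhaseState {ι : Type} [Fintype ι] [DecidableEq ι] (S : Finset ι) (f : ι → Bool) :
    StateSpace ι :=
  WithLp.toLp 2 fun x =>
    if x ∈ S then ((1 / Real.sqrt (S.card : ℝ) : ℝ) : ℂ) * (-1) ^ (f x).toNat else 0

/-- The matrix of `(|ψ⟩⟨ψ|)^{⊗ t}` in the product basis, whose elements are indexed by
`Fin t → ι`. -/
def dyadTensorPower {ι : Type} [Fintype ι] (t : ℕ) (ψ : StateSpace ι) :
    Matrix (Fin t → ι) (Fin t → ι) ℂ :=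
  Matrix.of fun x y => ∏ i, ψ (x i) * star (ψ (y i))

/-- The uniform average of a matrix-valued function over the `m`-element subsets of `ι`. -/
def subsetAverage {ι κ : Type} [Fintype ι] (m : ℕ) (F : Finset ι → Matrix κ κ ℂ) :
    Matrix κ κ ℂ :=
  ((Nat.choose (Fintype.card ι) m : ℂ))⁻¹ •
    ∑ S ∈ Finset.powersetCard m (Finset.univ : Finset ι), F S

/-- The probability of `f : ι → {0, 1}` when the values `f x` are independent and each
equals `1` with probability `(1 + b) / 2`. -/
def biasedWeight {ι : Type} [Fintype ι] (b : ℝ) (f : ι → Bool) : ℝ :=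
  ∏ x, if f x = true then (1 + b) / 2 else (1 - b) / 2

/-- The `t`-copy average of random biased subset-phase states: `S` is a uniformly random
`m`-subset and, independently, `f` has i.i.d. values with `P[f x = 1] = (1 + b) / 2`. -/
def biasedSubsetPhaseAverage (ι : Type) [Fintype ι] [DecidableEq ι] (t m : ℕ) (b : ℝ) :
    Matrix (Fin t → ι) (Fin t → ι) ℂ :=
  subsetAverage m fun S : Finset ι =>
    ∑ f : ι → Bool, (biasedWeight b f : ℂ) • dyadTensorPower t (subsetPhaseState S f)

/-- The `t`-copy average of random subset states with a uniform `m`-subset. -/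
def subsetStateAverage (ι : Type) [Fintype ι] [DecidableEq ι] (t m : ℕ) :
    Matrix (Fin t → ι) (Fin t → ι) ℂ :=
  subsetAverage m fun S : Finset ι => dyadTensorPower t (subsetState S)

/-- The `t`-copy average of random subset-phase states with a uniform `m`-subset and a
uniformly random Boolean function. -/
def uniformSubsetPhaseAverage (ι : Type) [Fintype ι] [DecidableEq ι] (t m : ℕ) :
    Matrix (Fin t → ι) (Fin t → ι) ℂ :=
  subsetAverage m fun S : Finset ι =>
    ((2 : ℂ) ^ Fintype.card ι)⁻¹ •
      ∑ f : ι → Bool, dyadTensorPower t (subsetPhaseState S f)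

/-- The Haar measure on pure states: the rotation-invariant surface measure of the complex
unit sphere, normalized to total mass one. -/
def haarState (ι : Type) [Fintype ι] : Measure (Metric.sphere (0 : StateSpace ι) 1) :=
  ((volume : Measure (StateSpace ι)).toSphere Set.univ)⁻¹ •
    (volume : Measure (StateSpace ι)).toSphere

/-- The `t`-copy Haar average `E_φ (|φ⟩⟨φ|)^{⊗ t}`, computed entry by entry (the entries are
bounded continuous functions of `φ`). -/
def haarAverage (ι : Type) [Fintype ι] (t : ℕ) : Matrix (Fin t → ι) (Fin t → ι) ℂ :=
  Matrix.of fun x y =>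
    ∫ φ : Metric.sphere (0 : StateSpace ι) 1,
      dyadTensorPower t (φ : StateSpace ι) x y ∂(haarState ι)

/-- The trace norm (Schatten 1-norm): the sum of the singular values, which are the square
roots of the eigenvalues of `Aᴴ * A`. -/
def traceNorm {κ : Type} [Fintype κ] [DecidableEq κ] (A : Matrix κ κ ℂ) : ℝ :=
  ∑ i, Real.sqrt ((Matrix.isHermitian_conjTranspose_mul_self A).eigenvalues i)

/-- The trace distance `½ ‖A - B‖₁`. -/
def traceDistance {κ : Type} [Fintype κ] [DecidableEq κ] (A B : Matrix κ κ ℂ) : ℝ :=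
  (1 / 2) * traceNorm (A - B)

end

/-! ### Trace norm of a Hermitian matrix and the common lower bound principle. -/

section TraceNorm

open scoped ComplexOrder

/-! Two density matrices that both dominate a positive matrix X in the Loewner order have trace
distance at most 1 - tr X (`traceDistance_le_of_common_lower_bound`). The proof exhibits such an X,
of trace close to 1, below both the subset-phase average ρ and the Haar average H.

Pack m disjoint blocks of size L = ⌊N/m⌋ into [N]. One uniform element from each block, followed by
a uniform permutation of [N], is a uniform m-subset; so before the permutation the unnormalized
state is a sum of i.i.d. block vectors (`biasedSubsetPhaseAverage_eq_spread`). Every coordinate of a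
block vector has mean -b/L. Centre the coordinates and keep only the tensor entries whose t
positions lie in distinct blocks. By independence and centring, what is discarded is uncorrelated
with what is kept (`sum_injAmp_mul_prodAmp`), so the second moment G of the kept part, once
permuted, satisfies G ≤ ρ. Its trace is P(t uniform blocks are distinct) · (1 - b²/L)^t.

The covariance inside a block is δ/L - b²/L². Adding the same independent noise ±b/L to all its
coordinates makes it δ/L, and the resulting second moment D satisfies D ≥ G. Now D, like H, is
invariant under relabelling the basis and permuting the copies, and its off-diagonal coherences
vanish as for H. These symmetries determine a matrix up to a scalar on tuples of distinct basis
elements, where D lives, so H ≥ (1 - r) D with r the H-weight of tuples with a repetition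
(`posSemidef_sub_injTrace_smul`). A fourth-moment computation and a union bound give r ≤ 2t²/(N +
1).

Hence X = (1 - r) G works, and the distance is at most r + t²/m + t b²/L. Since L ≥ N/(2m), the
constant 3 suffices. -/

theorem Matrix.IsHermitian.traceNorm_eq_sum_abs_eigenvalues {κ : Type} [Fintype κ]
    [DecidableEq κ] {M : Matrix κ κ ℂ} (hM : M.IsHermitian) :
    traceNorm M = ∑ i, |hM.eigenvalues i| := by
  -- The two eigenvalue families are indexed independently, so they are compared only as multisets,
  -- as roots of the characteristic polynomial of `M ^ 2`.
  have hroots : Multiset.map (fun i => ((hM.eigenvalues i ^ 2 : ℝ) : ℂ)) Finset.univ.val =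
      Multiset.map (fun i =>
        (((Matrix.isHermitian_conjTranspose_mul_self M).eigenvalues i : ℝ) : ℂ))
        Finset.univ.val := by
    have h1 := (Matrix.isHermitian_conjTranspose_mul_self M).roots_charpoly_eq_eigenvalues
    have h2 : M.conjTranspose * M = cfc (fun x : ℝ => x ^ 2) M := by
      rw [hM.eq, cfc_pow_id (R := ℝ) M 2 hM.isSelfAdjoint, sq]
    have h3 : (M.conjTranspose * M).charpoly =
        (Multiset.map (fun a => Polynomial.X - Polynomial.C a)
          (Multiset.map (fun i => ((hM.eigenvalues i ^ 2 : ℝ) : ℂ)) Finset.univ.val)).prod := by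
      rw [h2, hM.charpoly_cfc_eq, Multiset.map_map]
      rfl
    rw [h3, Polynomial.roots_multiset_prod_X_sub_C] at h1
    exact h1
  have hs := congrArg (fun s => (s.map (fun z : ℂ => Real.sqrt z.re)).sum) hroots
  simp only [Multiset.map_map, Function.comp_def, Complex.ofReal_re, Real.sqrt_sq_eq_abs] at hs
  exact hs.symm

/-- In an eigenbasis of `P - Q` each eigenvalue is a difference of two nonnegative diagonal entries,
whose sums over the basis are the traces. -/
theorem traceNorm_sub_le_of_posSemidef {κ : Type} [Fintype κ] [DecidableEq κ]
    {P Q : Matrix κ κ ℂ} (hP : P.PosSemidef) (hQ : Q.PosSemidef) :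
    traceNorm (P - Q) ≤ P.trace.re + Q.trace.re := by
  have hM : (P - Q).IsHermitian := hP.1.sub hQ.1
  rw [hM.traceNorm_eq_sum_abs_eigenvalues]
  set U : Matrix κ κ ℂ := (hM.eigenvectorUnitary : Matrix κ κ ℂ) with hU
  have hUU : U * U.conjTranspose = 1 := (Unitary.mem_iff.1 hM.eigenvectorUnitary.2).2
  have htr : ∀ R : Matrix κ κ ℂ, (U.conjTranspose * R * U).trace = R.trace := by
    intro R
    rw [Matrix.trace_mul_comm, ← mul_assoc, hUU, one_mul]
  have hdiag : ∀ i, hM.eigenvalues i =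
      ((U.conjTranspose * P * U) i i).re - ((U.conjTranspose * Q * U) i i).re := by
    intro i
    have h := hM.conjStarAlgAut_star_eigenvectorUnitary
    rw [Unitary.conjStarAlgAut_star_apply] at h
    have h' := congrFun (congrFun h i) i
    rw [Matrix.diagonal_apply_eq] at h'
    have h'' : ((U.conjTranspose * P * U) i i) - ((U.conjTranspose * Q * U) i i) =
        (hM.eigenvalues i : ℂ) := by
      rw [← Matrix.sub_apply, ← sub_mul, ← mul_sub]
      exact h'
    rw [← Complex.sub_re, h'', Complex.ofReal_re]
  have hnn : ∀ R : Matrix κ κ ℂ, R.PosSemidef → ∀ i, 0 ≤ ((U.conjTranspose * R * U) i i).re :=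
    fun R hR i => (Complex.nonneg_iff.1 (hR.conjTranspose_mul_mul_same U).diag_nonneg).1
  calc ∑ i, |hM.eigenvalues i|
      ≤ ∑ i, (((U.conjTranspose * P * U) i i).re + ((U.conjTranspose * Q * U) i i).re) := by
        refine Finset.sum_le_sum fun i _ => ?_
        rw [hdiag i, abs_le]
        constructor <;> linarith [hnn P hP i, hnn Q hQ i]
    _ = P.trace.re + Q.trace.re := by
        rw [Finset.sum_add_distrib, ← htr P, ← htr Q]
        simp [Matrix.trace]

theorem traceDistance_le_of_common_lower_bound {κ : Type} [Fintype κ] [DecidableEq κ]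
    {A B G : Matrix κ κ ℂ} (hA : (A - G).PosSemidef) (hB : (B - G).PosSemidef)
    (hAt : A.trace = 1) (hBt : B.trace = 1) :
    traceDistance A B ≤ 1 - G.trace.re := by
  have h := traceNorm_sub_le_of_posSemidef hA hB
  rw [sub_sub_sub_cancel_right] at h
  simp only [Matrix.trace_sub, Complex.sub_re, hAt, hBt, Complex.one_re] at h
  unfold traceDistance
  linarith

end TraceNorm

/-! ### Invariance of the Haar state under isometries. -/

section HaarMoments

open scoped Pointwise ComplexOrder

variable {ι : Type} [Fintype ι]

/-- The restriction of a linear isometry to the unit sphere. -/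
noncomputable def sphereMap (U : StateSpace ι ≃ₗᵢ[ℝ] StateSpace ι) :
    Metric.sphere (0 : StateSpace ι) 1 → Metric.sphere (0 : StateSpace ι) 1 :=
  fun φ => ⟨U φ, by simp⟩

theorem continuous_sphereMap (U : StateSpace ι ≃ₗᵢ[ℝ] StateSpace ι) :
    Continuous (sphereMap U) :=
  (U.continuous.comp continuous_subtype_val).subtype_mk _

theorem measurePreserving_sphereMap (U : StateSpace ι ≃ₗᵢ[ℝ] StateSpace ι) :
    MeasurePreserving (sphereMap U) (haarState ι) (haarState ι) := by
  have hm := (continuous_sphereMap U).measurable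
  suffices h : MeasurePreserving (sphereMap U)
      (volume : Measure (StateSpace ι)).toSphere (volume : Measure (StateSpace ι)).toSphere from
    h.smul_measure _
  refine ⟨hm, Measure.ext fun s hs => ?_⟩
  rw [Measure.map_apply hm hs, Measure.toSphere_apply' _ (hm hs), Measure.toSphere_apply' _ hs]
  congr 1
  -- `toSphere` measures `s` by the volume of the cone `(0,1) • s`; a linear isometry preserves
  -- volume and carries cones to cones.
  rw [← U.measurePreserving.measure_preimage_emb U.toHomeomorph.measurableEmbedding
    (Set.Ioo (0 : ℝ) 1 • (Subtype.val '' s))]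
  congr 1
  ext x
  simp only [Set.mem_smul, Set.mem_image, Set.mem_preimage]
  constructor
  · rintro ⟨r, hr, _, ⟨φ, hφ, rfl⟩, rfl⟩
    exact ⟨r, hr, _, ⟨_, hφ, rfl⟩, by simp [sphereMap]⟩
  · rintro ⟨r, hr, _, ⟨φ, hφ, rfl⟩, hx⟩
    have hφ' : sphereMap U (sphereMap U.symm φ) = φ := by
      ext1
      exact U.apply_symm_apply _
    refine ⟨r, hr, _, ⟨sphereMap U.symm φ, by rwa [hφ'], rfl⟩, ?_⟩
    apply U.injective
    simp only [map_smul]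
    rw [← hx]
    exact congrArg
      (fun ψ : Metric.sphere (0 : StateSpace ι) 1 => r • (ψ : StateSpace ι)) hφ'

theorem integral_haarState_comp (U : StateSpace ι ≃ₗᵢ[ℝ] StateSpace ι) {E : Type*}
    [NormedAddCommGroup E] [NormedSpace ℝ E] (F : StateSpace ι → E) :
    ∫ φ : Metric.sphere (0 : StateSpace ι) 1, F (U φ) ∂(haarState ι) =
      ∫ φ : Metric.sphere (0 : StateSpace ι) 1, F φ ∂(haarState ι) := by
  -- `F` is arbitrary, so the change of variables goes through a measurable embedding instead of
  -- measurability of the integrand.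
  have hemb : MeasurableEmbedding (sphereMap U) := by
    have hleft : Function.LeftInverse (sphereMap U.symm) (sphereMap U) := fun φ =>
      Subtype.ext (U.symm_apply_apply _)
    have hright : Function.RightInverse (sphereMap U.symm) (sphereMap U) := fun φ =>
      Subtype.ext (U.apply_symm_apply _)
    exact (MeasurableEquiv.mk ⟨_, _, hleft, hright⟩ (continuous_sphereMap U).measurable
      (continuous_sphereMap U.symm).measurable).measurableEmbedding
  exact (measurePreserving_sphereMap U).integral_comp hemb fun φ => F φ

instance [Nonempty ι] : IsProbabilityMeasure (haarState ι) := by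
  constructor
  rw [haarState, Measure.smul_apply, smul_eq_mul]
  refine ENNReal.inv_mul_cancel ?_ (measure_ne_top _ _)
  rw [Ne, Measure.measure_univ_eq_zero]
  exact Measure.toSphere_ne_zero _

theorem integrable_haarState [Nonempty ι] {E : Type*} [NormedAddCommGroup E]
    {F : StateSpace ι → E} (hF : Continuous F) :
    Integrable (fun φ : Metric.sphere (0 : StateSpace ι) 1 => F φ) (haarState ι) :=
  (hF.comp continuous_subtype_val).integrable_of_hasCompactSupport
    (HasCompactSupport.of_compactSpace _)

/-- Coordinatewise multiplication by phases. -/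
noncomputable def phaseIsometry (ζ : ι → unitary ℂ) : StateSpace ι ≃ₗᵢ[ℝ] StateSpace ι :=
  LinearIsometryEquiv.piLpCongrRight 2 fun i =>
    (LinearIsometryEquiv.ofSurjective
      { toLinearMap := LinearMap.mulLeft ℝ (ζ i : ℂ), norm_map' := fun z => by simp }
      fun z => ⟨star (ζ i : ℂ) * z, by
        change (ζ i : ℂ) * (star (ζ i : ℂ) * z) = z
        rw [← mul_assoc, (Unitary.mem_iff.1 (ζ i).2).2, one_mul]⟩)

theorem phaseIsometry_apply (ζ : ι → unitary ℂ) (φ : StateSpace ι) (a : ι) :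
    phaseIsometry ζ φ a = ζ a * φ a := rfl

/-- Relabelling of the computational basis. -/
noncomputable def relabelIsometry (σ : Equiv.Perm ι) : StateSpace ι ≃ₗᵢ[ℝ] StateSpace ι :=
  LinearIsometryEquiv.piLpCongrLeft 2 ℝ ℂ σ.symm

theorem relabelIsometry_apply (σ : Equiv.Perm ι) (φ : StateSpace ι) (a : ι) :
    relabelIsometry σ φ a = φ (σ a) := rfl

theorem sum_norm_sq_of_mem_sphere (φ : Metric.sphere (0 : StateSpace ι) 1) :
    ∑ a, ‖(φ : StateSpace ι) a‖ ^ 2 = 1 := by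
  rw [← EuclideanSpace.norm_sq_eq, norm_eq_of_mem_sphere, one_pow]

variable [DecidableEq ι]

/-- The linear map `(φ a, φ b) ↦ ((φ a + φ b) / √2, (φ a - φ b) / √2)`. -/
noncomputable def hadamardMap (a b : ι) : StateSpace ι →ₗ[ℝ] StateSpace ι where
  toFun := fun φ => WithLp.toLp 2 fun z =>
    if z = a then ((√2)⁻¹ : ℝ) * (φ a + φ b)
    else if z = b then ((√2)⁻¹ : ℝ) * (φ a - φ b) else φ z
  map_add' := fun φ ψ => by
    ext z
    simp only [PiLp.add_apply]
    split_ifs <;> ring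
  map_smul' := fun r φ => by
    ext z
    simp only [PiLp.smul_apply, RingHom.id_apply, Complex.real_smul]
    split_ifs <;> ring

theorem hadamardMap_apply (a b : ι) (φ : StateSpace ι) (z : ι) :
    hadamardMap a b φ z = if z = a then ((√2)⁻¹ : ℝ) * (φ a + φ b)
      else if z = b then ((√2)⁻¹ : ℝ) * (φ a - φ b) else φ z := rfl

theorem involutive_hadamardMap {a b : ι} (hab : a ≠ b) :
    Function.Involutive (hadamardMap a b) := fun φ => by
  have h2 : (((√2)⁻¹ : ℝ) : ℂ) * ((√2)⁻¹ : ℝ) = 1 / 2 := by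
    rw [← Complex.ofReal_mul, ← mul_inv, Real.mul_self_sqrt (by norm_num)]
    norm_num
  ext z
  simp only [hadamardMap_apply, if_true, hab.symm, if_false]
  split_ifs with h h'
  · subst h
    linear_combination (2 * φ z) * h2
  · subst h'
    linear_combination (2 * φ z) * h2
  · rfl

theorem norm_hadamardMap {a b : ι} (hab : a ≠ b) (φ : StateSpace ι) :
    ‖hadamardMap a b φ‖ = ‖φ‖ := by
  have key : ∀ ψ : StateSpace ι, ‖ψ‖ ^ 2 =
      ‖ψ a‖ ^ 2 + ‖ψ b‖ ^ 2 + ∑ z ∈ (Finset.univ.erase a).erase b, ‖ψ z‖ ^ 2 := by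
    intro ψ
    rw [EuclideanSpace.norm_sq_eq, ← Finset.add_sum_erase _ _ (Finset.mem_univ a),
      ← Finset.add_sum_erase _ _ (Finset.mem_erase.2 ⟨hab.symm, Finset.mem_univ b⟩), add_assoc]
  rw [← sq_eq_sq₀ (norm_nonneg _) (norm_nonneg _), key, key φ]
  congr 1
  · simp only [hadamardMap_apply, if_true, hab.symm, if_false, norm_mul, mul_pow,
      Complex.norm_real, norm_inv, Real.norm_eq_abs, inv_pow, sq_abs,
      Real.sq_sqrt (show (0 : ℝ) ≤ 2 by norm_num)]
    have := parallelogram_law_with_norm ℝ (φ a) (φ b)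
    nlinarith
  · refine Finset.sum_congr rfl fun z hz => ?_
    simp only [Finset.mem_erase] at hz
    simp [hadamardMap_apply, hz.1, hz.2.1]

/-- The two-coordinate Hadamard rotation as a linear isometry. -/
noncomputable def hadamardIsometry {a b : ι} (hab : a ≠ b) :
    StateSpace ι ≃ₗᵢ[ℝ] StateSpace ι where
  toLinearEquiv := LinearEquiv.ofInvolutive _ (involutive_hadamardMap hab)
  norm_map' := norm_hadamardMap hab

theorem hadamardIsometry_apply_left {a b : ι} (hab : a ≠ b) (φ : StateSpace ι) :
    hadamardIsometry hab φ a = ((√2)⁻¹ : ℝ) * (φ a + φ b) :=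
  (hadamardMap_apply a b φ a).trans (if_pos rfl)

end HaarMoments

/-! ### Fourth moments of Haar coordinates. -/

section FourthMoment

variable {ι : Type} [Fintype ι] [DecidableEq ι]

/-- The phase is absorbed by rotating coordinate `b`; then `(φ a + φ b) / √2` is a coordinate of a
rotated state, and the factor 4 is `√2 ^ 4`. -/
theorem integral_norm_add_phase_pow_four {a b : ι} (hab : a ≠ b) (ζ : unitary ℂ) :
    ∫ φ : Metric.sphere (0 : StateSpace ι) 1,
        ‖(φ : StateSpace ι) a + ζ * (φ : StateSpace ι) b‖ ^ 4 ∂(haarState ι) =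
      4 * ∫ φ : Metric.sphere (0 : StateSpace ι) 1, ‖(φ : StateSpace ι) a‖ ^ 4 ∂(haarState ι) := by
  have h1 := integral_haarState_comp (phaseIsometry (Function.update (fun _ : ι => 1) b ζ))
    fun φ : StateSpace ι => ‖φ a + φ b‖ ^ 4
  simp only [phaseIsometry_apply, Function.update_self, Function.update_of_ne hab,
    OneMemClass.coe_one, one_mul] at h1
  rw [h1, ← integral_haarState_comp (hadamardIsometry hab) fun φ => ‖φ a‖ ^ 4,
    ← integral_const_mul]
  congr 1
  ext φ
  rw [hadamardIsometry_apply_left, norm_mul, mul_pow, Complex.norm_real, norm_inv,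
    Real.norm_eq_abs, inv_pow, show (4 : ℕ) = 2 * 2 from rfl, pow_mul |√2|, sq_abs,
    Real.sq_sqrt (by norm_num)]
  ring

/-- Summing over the four fourth roots of unity cancels the phase-dependent cross terms. Integrated,
with A the fourth moment and M the mixed moment, it reads 16 A = 8 A + 16 M, so M = A/2. -/
theorem sum_norm_add_phase_pow_four (u v : ℂ) :
    ‖u + v‖ ^ 4 + ‖u + (-1) * v‖ ^ 4 + ‖u + Complex.I * v‖ ^ 4 + ‖u + (-Complex.I) * v‖ ^ 4 =
      4 * ‖u‖ ^ 4 + 4 * ‖v‖ ^ 4 + 16 * (‖u‖ ^ 2 * ‖v‖ ^ 2) := by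
  have h : ∀ z : ℂ, ‖z‖ ^ 4 = (z.re * z.re + z.im * z.im) ^ 2 := fun z => by
    rw [← Complex.normSq_apply, Complex.normSq_eq_norm_sq]; ring
  rw [h, h, h, h, h, h, ← Complex.normSq_eq_norm_sq, ← Complex.normSq_eq_norm_sq,
    Complex.normSq_apply, Complex.normSq_apply]
  simp only [Complex.add_re, Complex.add_im, Complex.mul_re, Complex.mul_im, Complex.neg_re,
    Complex.neg_im, Complex.I_re, Complex.I_im, Complex.one_re, Complex.one_im]
  ring

theorem integral_norm_sq_mul_norm_sq [Nonempty ι] {a b : ι} (hab : a ≠ b) :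
    ∫ φ : Metric.sphere (0 : StateSpace ι) 1,
        ‖(φ : StateSpace ι) a‖ ^ 2 * ‖(φ : StateSpace ι) b‖ ^ 2 ∂(haarState ι) =
      (∫ φ : Metric.sphere (0 : StateSpace ι) 1, ‖(φ : StateSpace ι) a‖ ^ 4 ∂(haarState ι)) / 2 := by
  have hI : Complex.I ∈ unitary ℂ := by simp [Unitary.mem_iff]
  have h1 := integral_norm_add_phase_pow_four hab 1
  have h2 := integral_norm_add_phase_pow_four hab (-1)
  have h3 := integral_norm_add_phase_pow_four hab ⟨Complex.I, hI⟩
  have h4 := integral_norm_add_phase_pow_four hab (-⟨Complex.I, hI⟩)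
  have hb := integral_haarState_comp (relabelIsometry (Equiv.swap a b))
    fun φ : StateSpace ι => ‖φ a‖ ^ 4
  simp only [relabelIsometry_apply, Equiv.swap_apply_left] at hb
  simp only [OneMemClass.coe_one, one_mul, Unitary.coe_neg] at h1 h2 h3 h4
  have hint : ∀ F : StateSpace ι → ℝ, Continuous F →
      Integrable (fun φ : Metric.sphere (0 : StateSpace ι) 1 => F φ) (haarState ι) :=
    fun F hF => integrable_haarState hF
  have key := congrArg
    (fun F : StateSpace ι → ℝ => ∫ φ : Metric.sphere (0 : StateSpace ι) 1, F φ ∂(haarState ι))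
    (funext fun φ : StateSpace ι => sum_norm_add_phase_pow_four (φ a) (φ b))
  simp only at key
  rw [integral_add
      (hint (fun φ => ‖φ a + φ b‖ ^ 4 + ‖φ a + (-1) * φ b‖ ^ 4 + ‖φ a + Complex.I * φ b‖ ^ 4)
        (by fun_prop))
      (hint (fun φ => ‖φ a + (-Complex.I) * φ b‖ ^ 4) (by fun_prop)),
    integral_add
      (hint (fun φ => ‖φ a + φ b‖ ^ 4 + ‖φ a + (-1) * φ b‖ ^ 4) (by fun_prop))
      (hint (fun φ => ‖φ a + Complex.I * φ b‖ ^ 4) (by fun_prop)),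
    integral_add (hint (fun φ => ‖φ a + φ b‖ ^ 4) (by fun_prop))
      (hint (fun φ => ‖φ a + (-1) * φ b‖ ^ 4) (by fun_prop)),
    integral_add (hint (fun φ => 4 * ‖φ a‖ ^ 4 + 4 * ‖φ b‖ ^ 4) (by fun_prop))
      (hint (fun φ => 16 * (‖φ a‖ ^ 2 * ‖φ b‖ ^ 2)) (by fun_prop)),
    integral_add (hint (fun φ => 4 * ‖φ a‖ ^ 4) (by fun_prop))
      (hint (fun φ => 4 * ‖φ b‖ ^ 4) (by fun_prop)),
    integral_const_mul, integral_const_mul, integral_const_mul, h1, h2, h3, h4, hb] at key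
  linarith

/-- Expand 1 = (∑ |φ a|²)² : each row contributes its fourth moment times 1 + (N - 1)/2 = (N + 1)/2.
-/
theorem integral_sum_norm_pow_four [Nonempty ι] :
    ∫ φ : Metric.sphere (0 : StateSpace ι) 1, ∑ a, ‖(φ : StateSpace ι) a‖ ^ 4 ∂(haarState ι) =
      2 / (Fintype.card ι + 1) := by
  set A : ι → ℝ := fun a =>
    ∫ φ : Metric.sphere (0 : StateSpace ι) 1, ‖(φ : StateSpace ι) a‖ ^ 4 ∂(haarState ι) with hA
  have hone : ∑ a, ∑ b, ∫ φ : Metric.sphere (0 : StateSpace ι) 1,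
      ‖(φ : StateSpace ι) a‖ ^ 2 * ‖(φ : StateSpace ι) b‖ ^ 2 ∂(haarState ι) = 1 := by
    have h : ∫ φ : Metric.sphere (0 : StateSpace ι) 1, ∑ a, ∑ b,
        ‖(φ : StateSpace ι) a‖ ^ 2 * ‖(φ : StateSpace ι) b‖ ^ 2 ∂(haarState ι) = 1 := by
      simp_rw [← Finset.mul_sum, sum_norm_sq_of_mem_sphere, mul_one, sum_norm_sq_of_mem_sphere]
      simp
    refine Eq.trans ?_ h
    rw [integral_finsetSum _ fun a _ => integrable_haarState
      (F := fun φ : StateSpace ι => ∑ b, ‖φ a‖ ^ 2 * ‖φ b‖ ^ 2) (by fun_prop)]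
    refine Finset.sum_congr rfl fun a _ => ?_
    rw [integral_finsetSum _ fun b _ => integrable_haarState
      (F := fun φ : StateSpace ι => ‖φ a‖ ^ 2 * ‖φ b‖ ^ 2) (by fun_prop)]
  have hrow : ∀ a, ∑ b, ∫ φ : Metric.sphere (0 : StateSpace ι) 1,
      ‖(φ : StateSpace ι) a‖ ^ 2 * ‖(φ : StateSpace ι) b‖ ^ 2 ∂(haarState ι) =
      A a * ((Fintype.card ι + 1) / 2) := by
    intro a
    rw [← Finset.add_sum_erase _ _ (Finset.mem_univ a),
      Finset.sum_congr rfl fun b hb => integral_norm_sq_mul_norm_sq (Finset.ne_of_mem_erase hb).symm,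
      Finset.sum_const, Finset.card_erase_of_mem (Finset.mem_univ a), Finset.card_univ,
      nsmul_eq_mul, Nat.cast_pred Fintype.card_pos]
    simp_rw [← pow_add]
    simp only [hA]
    ring
  rw [integral_finsetSum _ fun a _ => integrable_haarState
      (F := fun φ : StateSpace ι => ‖φ a‖ ^ 4) (by fun_prop)]
  rw [Finset.sum_congr rfl fun a _ => hrow a, ← Finset.sum_mul] at hone
  have : (0 : ℝ) < Fintype.card ι + 1 := by positivity
  rw [eq_div_iff this.ne']
  simp only [hA] at hone
  linarith

end FourthMoment

/-! ### Union bound for collisions among independent samples. -/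

section Collisions

/-- For `t` independent samples from the law `q`, each pair collides with probability `∑ q a ^ 2`;
the union bound runs over all ordered pairs, hence `t ^ 2`. -/
theorem sum_not_injective_prod_le {α : Type*} [Fintype α] (t : ℕ)
    (q : α → ℝ) (hq : ∀ a, 0 ≤ q a) (hsum : ∑ a, q a = 1)
    [DecidablePred fun x : Fin t → α => Function.Injective x] :
    ∑ x : Fin t → α, (if Function.Injective x then 0 else ∏ i, q (x i)) ≤
      (t : ℝ) ^ 2 * ∑ a, q a ^ 2 := by
  classical
  have hpair : ∀ i j : Fin t, i ≠ j →
      ∑ x : Fin t → α, (if x i = x j then ∏ k, q (x k) else 0) = ∑ a, q a ^ 2 := by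
    intro i j hij
    -- Summing over the common value `a` turns the collision constraint into a product over
    -- positions, so the sum over `x` factorizes.
    have h1 : ∀ x : Fin t → α, (if x i = x j then ∏ k, q (x k) else 0) =
        ∑ a, ∏ k, if k = i ∨ k = j then (if x k = a then q a else 0) else q (x k) := by
      intro x
      rw [Finset.sum_eq_single_of_mem (x i) (Finset.mem_univ _)]
      · by_cases h : x i = x j
        · rw [if_pos h]
          refine Finset.prod_congr rfl fun k _ => ?_
          split_ifs with hk hk'
          · rw [hk']
          · rcases hk with rfl | rfl
            · exact absurd rfl hk'
            · exact absurd h.symm hk'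
          · rfl
        · rw [if_neg h, eq_comm]
          refine Finset.prod_eq_zero (Finset.mem_univ j) ?_
          rw [if_pos (Or.inr rfl), if_neg (Ne.symm h)]
      · intro a _ ha
        refine Finset.prod_eq_zero (Finset.mem_univ i) ?_
        rw [if_pos (Or.inl rfl), if_neg ha.symm]
    rw [Finset.sum_congr rfl fun x _ => h1 x, Finset.sum_comm]
    refine Finset.sum_congr rfl fun a _ => ?_
    rw [← Fintype.prod_sum fun (k : Fin t) (c : α) =>
      if k = i ∨ k = j then (if c = a then q a else 0) else q c]
    have h2 : ∀ k : Fin t, (∑ c, if k = i ∨ k = j then (if c = a then q a else 0) else q c) =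
        if k ∈ ({i, j} : Finset (Fin t)) then q a else 1 := by
      intro k
      by_cases hk : k = i ∨ k = j
      · simp [hk]
      · simp [hk, hsum]
    rw [Finset.prod_congr rfl fun k _ => h2 k, Finset.prod_ite_mem, Finset.univ_inter,
      Finset.prod_const, Finset.card_pair hij]
  have hS : 0 ≤ ∑ a, q a ^ 2 := Finset.sum_nonneg fun a _ => sq_nonneg _
  calc ∑ x : Fin t → α, (if Function.Injective x then 0 else ∏ i, q (x i))
      ≤ ∑ x : Fin t → α, ∑ i, ∑ j,
          if i ≠ j then (if x i = x j then ∏ k, q (x k) else 0) else 0 := by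
        refine Finset.sum_le_sum fun x _ => ?_
        have hp : 0 ≤ ∏ k, q (x k) := Finset.prod_nonneg fun k _ => hq _
        have hnn : ∀ i j : Fin t,
            0 ≤ if i ≠ j then (if x i = x j then ∏ k, q (x k) else 0) else 0 := by
          intro i j
          split_ifs <;> simp [hp]
        split_ifs with h
        · exact Finset.sum_nonneg fun i _ => Finset.sum_nonneg fun j _ => hnn i j
        · obtain ⟨i, j, hx, hij⟩ := Function.not_injective_iff.1 h
          refine le_trans ?_ (Finset.single_le_sum
            (fun i _ => Finset.sum_nonneg fun j _ => hnn i j) (Finset.mem_univ i))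
          refine le_trans ?_ (Finset.single_le_sum (fun j _ => hnn i j) (Finset.mem_univ j))
          rw [if_pos hij, if_pos hx]
    _ = ∑ i : Fin t, ∑ j : Fin t, if i ≠ j then ∑ a, q a ^ 2 else 0 := by
        rw [Finset.sum_comm]
        refine Finset.sum_congr rfl fun i _ => ?_
        rw [Finset.sum_comm]
        refine Finset.sum_congr rfl fun j _ => ?_
        split_ifs with hij
        · exact hpair i j hij
        · simp
    _ ≤ ∑ _i : Fin t, ∑ _j : Fin t, ∑ a, q a ^ 2 := by
        refine Finset.sum_le_sum fun i _ => Finset.sum_le_sum fun j _ => ?_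
        split_ifs
        · exact le_rfl
        · exact hS
    _ = (t : ℝ) ^ 2 * ∑ a, q a ^ 2 := by
        simp
        ring

end Collisions

/-! ### Symmetry, positivity and collision weight of the Haar average. -/

section HaarAverage

open scoped ComplexOrder

theorem dyadTensorPower_eq_vecMulVec {ι : Type} [Fintype ι] (t : ℕ) (ψ : StateSpace ι) :
    dyadTensorPower t ψ =
      Matrix.vecMulVec (fun x => ∏ i, ψ (x i)) (star fun x => ∏ i, ψ (x i)) := by
  ext x y
  simp [dyadTensorPower, Matrix.vecMulVec_apply, Finset.prod_mul_distrib]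

theorem dyadTensorPower_apply_self {ι : Type} [Fintype ι] (t : ℕ) (ψ : StateSpace ι)
    (x : Fin t → ι) : dyadTensorPower t ψ x x = ((∏ i, ‖ψ (x i)‖ ^ 2 : ℝ) : ℂ) := by
  simp [dyadTensorPower, Complex.mul_conj, Complex.normSq_eq_norm_sq]

theorem dyadTensorPower_comp_perm {ι : Type} [Fintype ι] {t : ℕ} (ψ : StateSpace ι)
    (x y : Fin t → ι) (τ : Equiv.Perm (Fin t)) :
    dyadTensorPower t ψ x (y ∘ τ) = dyadTensorPower t ψ x y := by
  simp only [dyadTensorPower, Matrix.of_apply, Finset.prod_mul_distrib, Function.comp_apply]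
  rw [Equiv.prod_comp τ fun i => star (ψ (y i))]

theorem continuous_dyadTensorPower {ι : Type} [Fintype ι] (t : ℕ) (x y : Fin t → ι) :
    Continuous fun ψ : StateSpace ι => dyadTensorPower t ψ x y := by
  simp only [dyadTensorPower, Matrix.of_apply]
  fun_prop

variable {ι : Type} [Fintype ι]

theorem haarAverage_apply (t : ℕ) (x y : Fin t → ι) :
    haarAverage ι t x y = ∫ φ : Metric.sphere (0 : StateSpace ι) 1,
      dyadTensorPower t (φ : StateSpace ι) x y ∂(haarState ι) := rfl

theorem haarAverage_comp_perm {t : ℕ} (x y : Fin t → ι) (τ : Equiv.Perm (Fin t)) :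
    haarAverage ι t x (y ∘ τ) = haarAverage ι t x y := by
  simp only [haarAverage_apply, dyadTensorPower_comp_perm]

theorem haarAverage_relabel {t : ℕ} (σ : Equiv.Perm ι) (x y : Fin t → ι) :
    haarAverage ι t (σ ∘ x) (σ ∘ y) = haarAverage ι t x y :=
  integral_haarState_comp (relabelIsometry σ) fun φ => dyadTensorPower t φ x y

theorem isHermitian_haarAverage (t : ℕ) : (haarAverage ι t).IsHermitian := by
  ext x y
  rw [Matrix.conjTranspose_apply, haarAverage_apply, haarAverage_apply]
  refine (integral_conj (f := fun φ : Metric.sphere (0 : StateSpace ι) 1 =>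
    dyadTensorPower t (φ : StateSpace ι) y x)).symm.trans ?_
  congr 1
  ext φ
  simp [dyadTensorPower, mul_comm]

theorem posSemidef_haarAverage [Nonempty ι] (t : ℕ) : (haarAverage ι t).PosSemidef := by
  refine Matrix.PosSemidef.of_dotProduct_mulVec_nonneg (isHermitian_haarAverage t) fun v => ?_
  have h : star v ⬝ᵥ Matrix.mulVec (haarAverage ι t) v =
      ∫ φ : Metric.sphere (0 : StateSpace ι) 1,
        star v ⬝ᵥ Matrix.mulVec (dyadTensorPower t (φ : StateSpace ι)) v ∂(haarState ι) := by
    simp only [dotProduct, Matrix.mulVec]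
    have hc := continuous_dyadTensorPower (ι := ι) t
    rw [integral_finsetSum _ fun x _ => integrable_haarState
      (F := fun φ : StateSpace ι => star v x * ∑ y, dyadTensorPower t φ x y * v y)
      (by fun_prop)]
    refine Finset.sum_congr rfl fun x _ => ?_
    rw [integral_const_mul, integral_finsetSum _ fun y _ => integrable_haarState
      (F := fun φ : StateSpace ι => dyadTensorPower t φ x y * v y) (by fun_prop)]
    simp_rw [integral_mul_const]
    rfl
  rw [h]
  refine integral_nonneg fun φ => ?_
  simp only [dyadTensorPower_eq_vecMulVec]
  exact (Matrix.posSemidef_vecMulVec_self_star _).dotProduct_mulVec_nonneg v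

theorem trace_haarAverage [Nonempty ι] (t : ℕ) : (haarAverage ι t).trace = 1 := by
  have h : (haarAverage ι t).trace = ∫ φ : Metric.sphere (0 : StateSpace ι) 1,
      ∑ x, dyadTensorPower t (φ : StateSpace ι) x x ∂(haarState ι) := by
    rw [integral_finsetSum _ fun x _ => integrable_haarState
      (continuous_dyadTensorPower (ι := ι) t x x)]
    rfl
  rw [h]
  have h1 : ∀ φ : Metric.sphere (0 : StateSpace ι) 1,
      ∑ x, dyadTensorPower t (φ : StateSpace ι) x x = 1 := by
    intro φ
    simp only [dyadTensorPower_apply_self]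
    rw [← Complex.ofReal_sum,
      ← Fintype.prod_sum fun (_ : Fin t) (a : ι) => ‖(φ : StateSpace ι) a‖ ^ 2]
    simp [sum_norm_sq_of_mem_sphere]
  simp [h1]

/-- Flipping the sign of coordinate `x i₀` preserves the Haar measure but negates the entry, as this
coordinate occurs once in `x` and never in `y`. -/
theorem haarAverage_eq_zero_of_notMem_range [DecidableEq ι] {t : ℕ} {x y : Fin t → ι}
    (hx : Function.Injective x) (i₀ : Fin t) (hy : ∀ i, y i ≠ x i₀) :
    haarAverage ι t x y = 0 := by
  have h := integral_haarState_comp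
    (phaseIsometry (Function.update (fun _ : ι => 1) (x i₀) (-1)))
    fun φ => dyadTensorPower t φ x y
  have h1 : ∀ φ : StateSpace ι, dyadTensorPower t
      (phaseIsometry (Function.update (fun _ : ι => 1) (x i₀) (-1)) φ) x y =
        -dyadTensorPower t φ x y := by
    intro φ
    simp only [dyadTensorPower, Matrix.of_apply, phaseIsometry_apply]
    rw [← Finset.mul_prod_erase _ _ (Finset.mem_univ i₀),
      ← Finset.mul_prod_erase _ (fun i => φ (x i) * star (φ (y i))) (Finset.mem_univ i₀)]
    rw [Finset.prod_congr rfl fun i hi => by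
      rw [Function.update_of_ne (hx.ne (Finset.ne_of_mem_erase hi)),
        Function.update_of_ne (hy i), OneMemClass.coe_one, one_mul, one_mul]]
    rw [Function.update_self, Function.update_of_ne (hy i₀), Unitary.coe_neg, OneMemClass.coe_one,
      one_mul]
    ring
  simp only [h1, integral_neg] at h
  rw [← haarAverage_apply] at h
  exact self_eq_neg.1 h.symm

theorem sum_not_injective_haarAverage_le [DecidableEq ι] [Nonempty ι] (t : ℕ)
    [DecidablePred fun x : Fin t → ι => Function.Injective x] :
    ∑ x : Fin t → ι, (if Function.Injective x then 0 else (haarAverage ι t x x).re) ≤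
      (t : ℝ) ^ 2 * (2 / (Fintype.card ι + 1)) := by
  have hint : ∀ F : StateSpace ι → ℝ, Continuous F →
      Integrable (fun φ : Metric.sphere (0 : StateSpace ι) 1 => F φ) (haarState ι) :=
    fun F hF => integrable_haarState hF
  have hentry : ∀ x : Fin t → ι, (haarAverage ι t x x).re =
      ∫ φ : Metric.sphere (0 : StateSpace ι) 1,
        ∏ i, ‖(φ : StateSpace ι) (x i)‖ ^ 2 ∂(haarState ι) := by
    intro x
    rw [haarAverage_apply]
    simp only [dyadTensorPower_apply_self]
    rw [integral_complex_ofReal, Complex.ofReal_re]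
  have h : ∑ x : Fin t → ι, (if Function.Injective x then 0 else (haarAverage ι t x x).re) =
      ∫ φ : Metric.sphere (0 : StateSpace ι) 1, ∑ x : Fin t → ι,
        (if Function.Injective x then 0 else ∏ i, ‖(φ : StateSpace ι) (x i)‖ ^ 2)
        ∂(haarState ι) := by
    rw [integral_finsetSum _ fun x _ => hint (fun φ : StateSpace ι =>
      if Function.Injective x then 0 else ∏ i, ‖φ (x i)‖ ^ 2) (by split_ifs <;> fun_prop)]
    refine Finset.sum_congr rfl fun x _ => ?_
    split_ifs
    · simp
    · exact hentry x
  rw [h, ← integral_sum_norm_pow_four (ι := ι), ← integral_const_mul]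
  refine integral_mono (hint (fun φ : StateSpace ι => ∑ x : Fin t → ι,
    (if Function.Injective x then 0 else ∏ i, ‖φ (x i)‖ ^ 2))
      (continuous_finsetSum _ fun x _ => by split_ifs <;> fun_prop))
    (hint (fun φ : StateSpace ι => (t : ℝ) ^ 2 * ∑ a, ‖φ a‖ ^ 4) (by fun_prop)) fun φ => ?_
  refine (sum_not_injective_prod_le t (fun a => ‖(φ : StateSpace ι) a‖ ^ 2)
    (fun a => sq_nonneg _) (sum_norm_sq_of_mem_sphere φ)).trans (le_of_eq ?_)
  simp_rw [← pow_mul]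

end HaarAverage

/-! ### Second-moment matrices and orthogonal projection. -/

section Gram

open scoped ComplexOrder

/-- The second-moment matrix `∑ ω, W ω • |P ω⟩⟨P ω|` of a finite family of weighted real
vectors. -/
noncomputable def gramMatrix {Ω T : Type} [Fintype Ω] (W : Ω → ℝ) (P : Ω → T → ℝ) :
    Matrix T T ℂ :=
  Matrix.of fun x y => ((∑ ω, W ω * (P ω x * P ω y) : ℝ) : ℂ)

variable {Ω T : Type} [Fintype Ω] {W : Ω → ℝ} {P Z : Ω → T → ℝ}

theorem posSemidef_gramMatrix [Fintype T] (hW : ∀ ω, 0 ≤ W ω) :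
    (gramMatrix W P).PosSemidef := by
  have h : gramMatrix W P = ∑ ω, (W ω : ℂ) •
      Matrix.vecMulVec (fun x => (P ω x : ℂ)) (star fun x => (P ω x : ℂ)) := by
    ext x y
    simp [gramMatrix, Matrix.sum_apply, Matrix.vecMulVec_apply]
  rw [h]
  exact Matrix.posSemidef_sum _ fun ω _ =>
    (Matrix.posSemidef_vecMulVec_self_star _).smul (by exact_mod_cast hW ω)

/-- Pythagoras: the hypothesis says that `P - Z` is uncorrelated with `Z`. For nonnegative weights
this makes the difference of second moments positive semidefinite. -/
theorem gramMatrix_sub_of_orthogonal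
    (h : ∀ x y, ∑ ω, W ω * (Z ω x * P ω y) = ∑ ω, W ω * (Z ω x * Z ω y)) :
    gramMatrix W P - gramMatrix W Z = gramMatrix W (P - Z) := by
  ext x y
  have h' : ∀ x y, ∑ ω, W ω * (P ω x * Z ω y) = ∑ ω, W ω * (Z ω x * Z ω y) := fun x y => by
    rw [Finset.sum_congr rfl fun ω _ => by rw [mul_comm (P ω x)], h y x]
    exact Finset.sum_congr rfl fun ω _ => by ring
  simp only [gramMatrix, Matrix.sub_apply, Matrix.of_apply, Pi.sub_apply, ← Complex.ofReal_sub]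
  congr 1
  simp only [sub_mul, mul_sub, Finset.sum_sub_distrib]
  rw [h, h']
  ring

end Gram

/-! ### Correlations of product amplitudes over independent blocks. -/

section BlockChaos

variable {B A Λ : Type} {t : ℕ}

/-- The amplitude `∏ i, X (ω βᵢ) ℓᵢ` of the basis tuple `(βᵢ, ℓᵢ)ᵢ`. -/
def prodAmp (X : A → Λ → ℝ) (ω : B → A) (κ : Fin t → B × Λ) : ℝ :=
  ∏ i, X (ω (κ i).1) (κ i).2

open Classical in
/-- The part of `prodAmp` on the tuples whose blocks are distinct. -/
noncomputable def injAmp (X : A → Λ → ℝ) (ω : B → A) (κ : Fin t → B × Λ) : ℝ :=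
  if Function.Injective fun i => (κ i).1 then prodAmp X ω κ else 0

theorem injAmp_of_injective {X : A → Λ → ℝ} {ω : B → A} {κ : Fin t → B × Λ}
    (h : Function.Injective fun i => (κ i).1) : injAmp X ω κ = prodAmp X ω κ := if_pos h

theorem injAmp_of_not_injective {X : A → Λ → ℝ} {ω : B → A} {κ : Fin t → B × Λ}
    (h : ¬Function.Injective fun i => (κ i).1) : injAmp X ω κ = 0 := if_neg h

theorem prodAmp_comp_perm (X : A → Λ → ℝ) (ω : B → A) (κ : Fin t → B × Λ)
    (τ : Equiv.Perm (Fin t)) : prodAmp X ω (κ ∘ τ) = prodAmp X ω κ :=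
  Equiv.prod_comp τ fun i => X (ω (κ i).1) (κ i).2

theorem injAmp_comp_perm (X : A → Λ → ℝ) (ω : B → A) (κ : Fin t → B × Λ)
    (τ : Equiv.Perm (Fin t)) : injAmp X ω (κ ∘ τ) = injAmp X ω κ := by
  have h : (Function.Injective fun i => ((κ ∘ τ) i).1) ↔ Function.Injective fun i => (κ i).1 :=
    τ.injective_comp fun i => (κ i).1
  by_cases hκ : Function.Injective fun i => (κ i).1
  · rw [injAmp_of_injective hκ, injAmp_of_injective (h.2 hκ), prodAmp_comp_perm]
  · rw [injAmp_of_not_injective hκ, injAmp_of_not_injective (mt h.1 hκ)]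

theorem filter_eq_singleton_of_injective [DecidableEq B] {β : Fin t → B} (hβ : Function.Injective β)
    (i₀ : Fin t) : Finset.univ.filter (fun i => β i = β i₀) = {i₀} := by
  ext i
  simp [hβ.eq_iff]

variable [Fintype B] [DecidableEq B] [Fintype A] {w : A → ℝ} {Y F F' : A → Λ → ℝ}

/-- Independence of the blocks: group the positions of both tuples by block and take the expectation
block by block. -/
theorem sum_prodAmp_mul_prodAmp (w : A → ℝ) (Y F : A → Λ → ℝ) (κ κ' : Fin t → B × Λ) :
    ∑ ω : B → A, (∏ b, w (ω b)) * (prodAmp Y ω κ * prodAmp F ω κ') =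
      ∏ b, ∑ a, w a * ((∏ i with (κ i).1 = b, Y a (κ i).2) *
        ∏ j with (κ' j).1 = b, F a (κ' j).2) := by
  rw [Fintype.prod_sum]
  refine Finset.sum_congr rfl fun ω _ => ?_
  rw [Finset.prod_mul_distrib, Finset.prod_mul_distrib]
  congr 2
  · rw [prodAmp, ← Finset.prod_fiberwise _ fun i => (κ i).1]
    refine Finset.prod_congr rfl fun b _ => Finset.prod_congr rfl fun i hi => ?_
    rw [(Finset.mem_filter.1 hi).2]
  · rw [prodAmp, ← Finset.prod_fiberwise _ fun i => (κ' i).1]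
    refine Finset.prod_congr rfl fun b _ => Finset.prod_congr rfl fun i hi => ?_
    rw [(Finset.mem_filter.1 hi).2]

theorem sum_prodAmp_eq_zero_of_notMem (hY : ∀ l, ∑ a, w a * Y a l = 0) {κ κ' : Fin t → B × Λ}
    (hκ : Function.Injective fun i => (κ i).1) (i₀ : Fin t) (h : ∀ j, (κ' j).1 ≠ (κ i₀).1) :
    ∑ ω : B → A, (∏ b, w (ω b)) * (prodAmp Y ω κ * prodAmp F ω κ') = 0 := by
  rw [sum_prodAmp_mul_prodAmp]
  refine Finset.prod_eq_zero (Finset.mem_univ (κ i₀).1) ?_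
  rw [filter_eq_singleton_of_injective hκ i₀, Finset.filter_false_of_mem fun j _ => h j]
  simpa using hY (κ i₀).2

theorem exists_perm_of_range_subset {α : Type*} {β β' : Fin t → α} (hβ : Function.Injective β)
    (h : ∀ i, ∃ j, β' j = β i) : ∃ τ : Equiv.Perm (Fin t), ∀ i, β' (τ i) = β i := by
  choose s hs using h
  have hsinj : Function.Injective s := fun i j hij => hβ (by rw [← hs, ← hs, hij])
  exact ⟨Equiv.ofBijective s (Finite.injective_iff_bijective.1 hsinj), hs⟩

theorem injective_of_range_subset {α : Type*} {β β' : Fin t → α} (hβ : Function.Injective β)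
    (h : ∀ i, ∃ j, β' j = β i) : Function.Injective β' := by
  obtain ⟨τ, hτ⟩ := exists_perm_of_range_subset hβ h
  have : β' = β ∘ τ.symm := by
    ext i
    rw [Function.comp_apply, ← hτ, Equiv.apply_symm_apply]
  rw [this]
  exact hβ.comp τ.symm.injective

/-- A block visited by `κ` but not by `κ'` contributes a vanishing mean. Otherwise the `t` positions
of `κ'` cover the `t` distinct blocks of `κ`, once each, so every visited block contributes one
correlation of `Y` with `F`, where `hF` applies. With `F' = Y` this is the projection identity
behind the lower bound. -/
theorem sum_injAmp_mul_prodAmp (hY : ∀ l, ∑ a, w a * Y a l = 0)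
    (hF : ∀ l l', ∑ a, w a * (Y a l * F a l') = ∑ a, w a * (Y a l * F' a l'))
    (κ κ' : Fin t → B × Λ) :
    ∑ ω : B → A, (∏ b, w (ω b)) * (injAmp Y ω κ * prodAmp F ω κ') =
      ∑ ω : B → A, (∏ b, w (ω b)) * (injAmp Y ω κ * injAmp F' ω κ') := by
  by_cases hκ : Function.Injective fun i => (κ i).1
  swap
  · simp [injAmp_of_not_injective hκ]
  simp only [injAmp_of_injective hκ]
  by_cases hsub : ∀ i, ∃ j, (κ' j).1 = (κ i).1
  · have hκ' : Function.Injective fun i => (κ' i).1 := injective_of_range_subset hκ hsub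
    have hsub' : ∀ j, ∃ i, (κ i).1 = (κ' j).1 := by
      obtain ⟨τ, hτ⟩ := exists_perm_of_range_subset
        (β := fun i => (κ i).1) (β' := fun i => (κ' i).1) hκ hsub
      intro j
      refine ⟨τ.symm j, ?_⟩
      rw [← hτ, Equiv.apply_symm_apply]
    simp only [injAmp_of_injective hκ']
    rw [sum_prodAmp_mul_prodAmp, sum_prodAmp_mul_prodAmp]
    refine Finset.prod_congr rfl fun b _ => ?_
    by_cases hb : ∃ i, (κ i).1 = b
    · obtain ⟨i, rfl⟩ := hb
      obtain ⟨j, hj⟩ := hsub i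
      rw [filter_eq_singleton_of_injective hκ i, ← hj, filter_eq_singleton_of_injective hκ' j]
      simpa using hF (κ i).2 (κ' j).2
    · have hb' : ∀ j, (κ' j).1 ≠ b := fun j hj => by
        obtain ⟨i, hi⟩ := hsub' j
        exact hb ⟨i, hi.trans hj⟩
      rw [Finset.filter_false_of_mem (s := Finset.univ) (p := fun j => (κ' j).1 = b)
        fun j _ => hb' j]
      simp
  · push Not at hsub
    obtain ⟨i₀, h⟩ := hsub
    rw [sum_prodAmp_eq_zero_of_notMem hY hκ i₀ h]
    by_cases hκ' : Function.Injective fun i => (κ' i).1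
    · simp only [injAmp_of_injective hκ']
      rw [sum_prodAmp_eq_zero_of_notMem hY hκ i₀ h]
    · simp [injAmp_of_not_injective hκ']

/-- The block of `κ i₀` is either missed by `κ'`, giving a zero mean, or visited at another element,
giving a zero covariance. -/
theorem sum_injAmp_mul_injAmp_eq_zero (hY : ∀ l, ∑ a, w a * Y a l = 0)
    (hd : ∀ l l', l ≠ l' → ∑ a, w a * (Y a l * Y a l') = 0) {κ κ' : Fin t → B × Λ}
    (i₀ : Fin t) (h : ∀ j, κ' j ≠ κ i₀) :
    ∑ ω : B → A, (∏ b, w (ω b)) * (injAmp Y ω κ * injAmp Y ω κ') = 0 := by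
  by_cases hκ : Function.Injective fun i => (κ i).1
  swap
  · simp [injAmp_of_not_injective hκ]
  by_cases hκ' : Function.Injective fun i => (κ' i).1
  swap
  · simp [injAmp_of_not_injective hκ']
  simp only [injAmp_of_injective hκ, injAmp_of_injective hκ']
  by_cases hj : ∃ j, (κ' j).1 = (κ i₀).1
  · obtain ⟨j, hj⟩ := hj
    rw [sum_prodAmp_mul_prodAmp]
    refine Finset.prod_eq_zero (Finset.mem_univ (κ i₀).1) ?_
    rw [filter_eq_singleton_of_injective hκ i₀, ← hj, filter_eq_singleton_of_injective hκ' j]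
    simpa using hd _ _ fun hl => h j (Prod.ext hj hl.symm)
  · push Not at hj
    exact sum_prodAmp_eq_zero_of_notMem hY hκ i₀ hj

theorem sum_injAmp_sq {v : ℝ} (hw : ∑ a, w a = 1) (hv : ∀ l, ∑ a, w a * (Y a l * Y a l) = v)
    {κ : Fin t → B × Λ} (hκ : Function.Injective fun i => (κ i).1) :
    ∑ ω : B → A, (∏ b, w (ω b)) * (injAmp Y ω κ * injAmp Y ω κ) = v ^ t := by
  simp only [injAmp_of_injective hκ]
  rw [sum_prodAmp_mul_prodAmp]
  have h : ∀ b, (∑ a, w a * ((∏ i with (κ i).1 = b, Y a (κ i).2) *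
      ∏ j with (κ j).1 = b, Y a (κ j).2)) =
      if b ∈ Finset.univ.image (fun i => (κ i).1) then v else 1 := by
    intro b
    by_cases hb : ∃ i, (κ i).1 = b
    · obtain ⟨i, rfl⟩ := hb
      rw [filter_eq_singleton_of_injective hκ i]
      simpa using hv (κ i).2
    · rw [if_neg (by simpa using hb)]
      rw [Finset.filter_false_of_mem fun j _ hj => hb ⟨j, hj⟩]
      simpa using hw
  rw [Finset.prod_congr rfl fun b _ => h b, Finset.prod_ite_mem, Finset.univ_inter,
    Finset.prod_const, Finset.card_image_of_injective _ hκ, Finset.card_univ, Fintype.card_fin]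

end BlockChaos

/-! ### Moments of a single block. -/

section BlockModel

variable {Λ : Type} [Fintype Λ]

/-- The sign `(-1)^s`. -/
def boolSign (s : Bool) : ℝ := (-1) ^ s.toNat

/-- The law of a biased bit. -/
noncomputable def bitWeight (b : ℝ) (s : Bool) : ℝ :=
  if s = true then (1 + b) / 2 else (1 - b) / 2

/-- The law of a uniform element of the block, a biased bit and an auxiliary fair bit. -/
noncomputable def blockWeight (b : ℝ) (a : Λ × Bool × Bool) : ℝ :=
  (Fintype.card Λ : ℝ)⁻¹ * (bitWeight b a.2.1 * (1 / 2))

theorem blockWeight_nonneg {b : ℝ} (hb : b ∈ Set.Icc (-1 : ℝ) 1) (a : Λ × Bool × Bool) :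
    0 ≤ blockWeight b a := by
  have : 0 ≤ bitWeight b a.2.1 := by
    unfold bitWeight
    split_ifs <;> linarith [hb.1, hb.2]
  unfold blockWeight
  positivity

/-- The bit `true` has sign -1, so the weight `1 + b` goes with -1; the quarter combines the biased
bit's 1/2 with that of the fair bit. -/
theorem sum_block (G : Λ → ℝ → ℝ → ℝ) (b : ℝ) :
    ∑ a : Λ × Bool × Bool, blockWeight b a * G a.1 (boolSign a.2.1) (boolSign a.2.2) =
      (Fintype.card Λ : ℝ)⁻¹ * ∑ c, ((1 + b) / 4 * (G c (-1) (-1) + G c (-1) 1) +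
        (1 - b) / 4 * (G c 1 (-1) + G c 1 1)) := by
  rw [Fintype.sum_prod_type, Finset.mul_sum]
  refine Finset.sum_congr rfl fun c _ => ?_
  simp only [Fintype.sum_prod_type, Fintype.sum_bool, blockWeight, bitWeight, boolSign]
  simp
  ring

theorem sum_blockWeight [Nonempty Λ] (b : ℝ) : ∑ a : Λ × Bool × Bool, blockWeight b a = 1 := by
  have h := sum_block (fun (_ : Λ) _ _ => (1 : ℝ)) b
  simp only [mul_one] at h
  rw [h]
  simp
  field_simp
  norm_num

variable [DecidableEq Λ]

/-- The amplitudes of a block, supported on its chosen element. -/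
def blockAmp (a : Λ × Bool × Bool) (l : Λ) : ℝ := if a.1 = l then boolSign a.2.1 else 0

/-- The centred amplitudes of a block. -/
noncomputable def centredAmp (b : ℝ) (a : Λ × Bool × Bool) (l : Λ) : ℝ :=
  blockAmp a l + b / Fintype.card Λ

/-- The centred amplitudes, with noise making the coordinates of a block uncorrelated. -/
noncomputable def decorrelatedAmp (b : ℝ) (a : Λ × Bool × Bool) (l : Λ) : ℝ :=
  centredAmp b a l + b / Fintype.card Λ * boolSign a.2.2

theorem sum_centredAmp_mul_decorrelatedAmp (b : ℝ) (l l' : Λ) :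
    ∑ a, blockWeight b a * (centredAmp b a l * decorrelatedAmp b a l') =
      ∑ a, blockWeight b a * (centredAmp b a l * centredAmp b a l') := by
  refine (sum_block (fun c s g => ((if c = l then s else 0) + b / Fintype.card Λ) *
    ((if c = l' then s else 0) + b / Fintype.card Λ + b / Fintype.card Λ * g)) b).trans
    (Eq.trans ?_ (sum_block (fun c s _ => ((if c = l then s else 0) + b / Fintype.card Λ) *
      ((if c = l' then s else 0) + b / Fintype.card Λ)) b).symm)
  congr 1
  refine Finset.sum_congr rfl fun c _ => ?_
  ring

variable [Nonempty Λ] (b : ℝ)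

theorem sum_centredAmp (l : Λ) : ∑ a, blockWeight b a * centredAmp b a l = 0 := by
  refine (sum_block (fun c s _ => (if c = l then s else 0) + b / Fintype.card Λ) b).trans ?_
  rw [Finset.sum_congr rfl fun c _ => show _ = (if c = l then -b else 0) + b / Fintype.card Λ by
    split_ifs <;> ring]
  rw [Finset.sum_add_distrib]
  simp
  field_simp
  ring

theorem sum_decorrelatedAmp (l : Λ) : ∑ a, blockWeight b a * decorrelatedAmp b a l = 0 := by
  refine (sum_block (fun c s g => (if c = l then s else 0) + b / Fintype.card Λ +
    b / Fintype.card Λ * g) b).trans ?_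
  rw [Finset.sum_congr rfl fun c _ => show _ = (if c = l then -b else 0) + b / Fintype.card Λ by
    split_ifs <;> ring]
  rw [Finset.sum_add_distrib]
  simp
  field_simp
  ring

theorem sum_centredAmp_mul_blockAmp (l l' : Λ) :
    ∑ a, blockWeight b a * (centredAmp b a l * blockAmp a l') =
      ∑ a, blockWeight b a * (centredAmp b a l * centredAmp b a l') := by
  have h := sum_centredAmp b l
  have : ∀ a, blockWeight b a * (centredAmp b a l * centredAmp b a l') =
      blockWeight b a * (centredAmp b a l * blockAmp a l') +
        blockWeight b a * centredAmp b a l * (b / Fintype.card Λ) := fun a => by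
    rw [centredAmp, centredAmp]; ring
  simp_rw [this, Finset.sum_add_distrib, ← Finset.sum_mul, h]
  ring

theorem sum_centredAmp_sq (l : Λ) :
    ∑ a, blockWeight b a * (centredAmp b a l * centredAmp b a l) =
      (Fintype.card Λ : ℝ)⁻¹ * (1 - b ^ 2 / Fintype.card Λ) := by
  rw [← sum_centredAmp_mul_blockAmp]
  refine (sum_block (fun c s _ => ((if c = l then s else 0) + b / Fintype.card Λ) *
    (if c = l then s else 0)) b).trans ?_
  rw [Finset.sum_congr rfl fun c _ => show _ =
    (if c = l then 1 - b ^ 2 / Fintype.card Λ else 0) by split_ifs <;> ring]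
  simp

/-- The centred covariance has the extra term `-b²/|Λ|²` in every entry, diagonal or not; noise
shared by all coordinates adds back exactly that rank-one matrix. -/
theorem sum_decorrelatedAmp_mul (l l' : Λ) :
    ∑ a, blockWeight b a * (decorrelatedAmp b a l * decorrelatedAmp b a l') =
      if l = l' then (Fintype.card Λ : ℝ)⁻¹ else 0 := by
  refine (sum_block (fun c s g =>
    ((if c = l then s else 0) + b / Fintype.card Λ + b / Fintype.card Λ * g) *
    ((if c = l' then s else 0) + b / Fintype.card Λ + b / Fintype.card Λ * g)) b).trans ?_
  rw [Finset.sum_congr rfl fun c _ => show _ =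
    (if c = l then if l = l' then (1 : ℝ) else 0 else 0) -
      (if c = l then b ^ 2 / Fintype.card Λ else 0) -
      (if c = l' then b ^ 2 / Fintype.card Λ else 0) + 2 * (b / Fintype.card Λ) ^ 2 by
    by_cases h : c = l
    · subst h
      split_ifs <;> ring
    · simp only [h, if_false]
      split_ifs <;> ring]
  rw [Finset.sum_add_distrib, Finset.sum_sub_distrib, Finset.sum_sub_distrib]
  simp
  split_ifs <;> field_simp <;> ring

end BlockModel

/-! ### Averaging over relabellings of the basis. -/

section Spread

open scoped ComplexOrder

variable {ι K : Type} [DecidableEq ι] {t : ℕ}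

/-- The isometry sending the basis tuple `κ` to `j ∘ κ`. -/
def tupleIsometry (t : ℕ) (j : K → ι) : Matrix (Fin t → ι) (Fin t → K) ℂ :=
  Matrix.of fun x κ => if x = j ∘ κ then 1 else 0

theorem conjTranspose_tupleIsometry_mul [Fintype ι] [DecidableEq K] {j : K → ι} (hj : Function.Injective j) :
    (tupleIsometry t j).conjTranspose * tupleIsometry t j = 1 := by
  ext κ κ'
  simp only [Matrix.mul_apply, Matrix.conjTranspose_apply, tupleIsometry, Matrix.of_apply]
  rw [Finset.sum_eq_single_of_mem (j ∘ κ') (Finset.mem_univ _) fun x _ hx => by simp [hx]]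
  simp [Matrix.one_apply, hj.comp_left.eq_iff, eq_comm]

variable [Fintype K]

theorem conj_tupleIsometry_apply (j : K → ι) (M : Matrix (Fin t → K) (Fin t → K) ℂ)
    (x y : Fin t → ι) :
    (tupleIsometry t j * M * (tupleIsometry t j).conjTranspose) x y =
      ∑ κ, ∑ κ', if x = j ∘ κ ∧ y = j ∘ κ' then M κ κ' else 0 := by
  simp only [Matrix.mul_apply, Matrix.conjTranspose_apply, tupleIsometry, Matrix.of_apply,
    Finset.sum_mul]
  rw [Finset.sum_comm]
  refine Finset.sum_congr rfl fun κ _ => Finset.sum_congr rfl fun κ' _ => ?_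
  by_cases h : x = j ∘ κ <;> by_cases h' : y = j ∘ κ' <;> simp [h, h']

variable [Fintype ι]

/-- The average of the images of `M` under the relabellings `π ∘ e` of a fixed embedding `e`. -/
noncomputable def spread (e : K → ι) (M : Matrix (Fin t → K) (Fin t → K) ℂ) :
    Matrix (Fin t → ι) (Fin t → ι) ℂ :=
  (Fintype.card (Equiv.Perm ι) : ℂ)⁻¹ • ∑ π : Equiv.Perm ι,
    tupleIsometry t (π ∘ e) * M * (tupleIsometry t (π ∘ e)).conjTranspose

variable {e : K → ι} {M M' : Matrix (Fin t → K) (Fin t → K) ℂ}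

theorem spread_sub : spread e (M - M') = spread e M - spread e M' := by
  simp only [spread, Matrix.mul_sub, Matrix.sub_mul, Finset.sum_sub_distrib, smul_sub]

theorem posSemidef_spread (hM : M.PosSemidef) : (spread e M).PosSemidef := by
  refine (Matrix.posSemidef_sum _ fun π _ => hM.mul_mul_conjTranspose_same _).smul ?_
  exact inv_nonneg.2 (Nat.cast_nonneg _)

theorem trace_spread [DecidableEq K] (he : Function.Injective e) : (spread e M).trace = M.trace := by
  have h : ∀ π : Equiv.Perm ι, (tupleIsometry t (π ∘ e) * M *
      (tupleIsometry t (π ∘ e)).conjTranspose).trace = M.trace := fun π => by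
    rw [Matrix.trace_mul_comm, ← Matrix.mul_assoc,
      conjTranspose_tupleIsometry_mul (π.injective.comp he), Matrix.one_mul]
  have hne : (Fintype.card (Equiv.Perm ι) : ℂ) ≠ 0 := by exact_mod_cast Fintype.card_ne_zero
  simp only [spread, Matrix.trace_smul, Matrix.trace_sum, h, Finset.sum_const,
    Finset.card_univ, nsmul_eq_mul, smul_eq_mul]
  rw [← mul_assoc, inv_mul_cancel₀ hne, one_mul]

theorem spread_comp_perm
    (hM : ∀ κ κ' (τ : Equiv.Perm (Fin t)), M κ (κ' ∘ τ) = M κ κ')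
    (x y : Fin t → ι) (τ : Equiv.Perm (Fin t)) :
    spread e M x (y ∘ τ) = spread e M x y := by
  simp only [spread, Matrix.smul_apply, Matrix.sum_apply, conj_tupleIsometry_apply]
  congr 1
  refine Finset.sum_congr rfl fun π _ => Finset.sum_congr rfl fun κ _ => ?_
  refine Fintype.sum_equiv (Equiv.arrowCongr τ (Equiv.refl K)) _ _ fun κ' => ?_
  have h1 : (Equiv.arrowCongr τ (Equiv.refl K)) κ' = κ' ∘ τ.symm := rfl
  have h2 : (y ∘ τ = (π ∘ e) ∘ κ') ↔ y = (π ∘ e) ∘ (κ' ∘ τ.symm) := by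
    rw [← Function.comp_assoc, Equiv.eq_comp_symm]
  rw [h1, hM]
  simp only [h2]

theorem spread_relabel (σ : Equiv.Perm ι) (x y : Fin t → ι) :
    spread e M (σ ∘ x) (σ ∘ y) = spread e M x y := by
  simp only [spread, Matrix.smul_apply, Matrix.sum_apply, conj_tupleIsometry_apply]
  congr 1
  -- Relabelling by `σ` only shifts the uniform permutation, `π ↦ σ⁻¹ π`.
  refine Fintype.sum_equiv (Equiv.mulLeft σ⁻¹) _ _ fun π => ?_
  refine Finset.sum_congr rfl fun κ _ => Finset.sum_congr rfl fun κ' _ => ?_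
  have h : ∀ (z : Fin t → ι) (μ : Fin t → K), (σ ∘ z = (π ∘ e) ∘ μ) ↔
      z = ((Equiv.mulLeft σ⁻¹ π) ∘ e) ∘ μ := by
    intro z μ
    simp only [funext_iff, Function.comp_apply, Equiv.coe_mulLeft, Equiv.Perm.mul_apply,
      Equiv.Perm.eq_inv_iff_eq]
  simp only [h]

theorem spread_eq_zero_of_notMem
    (hM : ∀ κ κ' (i₀ : Fin t), (∀ j, κ' j ≠ κ i₀) → M κ κ' = 0)
    {x y : Fin t → ι} (i₀ : Fin t) (h : ∀ j, y j ≠ x i₀) : spread e M x y = 0 := by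
  simp only [spread, Matrix.smul_apply, Matrix.sum_apply, conj_tupleIsometry_apply]
  rw [Finset.sum_eq_zero, smul_zero]
  intro π _
  refine Finset.sum_eq_zero fun κ _ => Finset.sum_eq_zero fun κ' _ => ?_
  split_ifs with hxy
  · obtain ⟨rfl, rfl⟩ := hxy
    exact hM κ κ' i₀ fun j hj => h j (congrArg (π ∘ e) hj)
  · rfl

theorem spread_eq_zero_of_not_injective (he : Function.Injective e)
    (hM : ∀ κ κ', ¬Function.Injective κ → M κ κ' = 0)
    {x y : Fin t → ι} (h : ¬Function.Injective x) : spread e M x y = 0 := by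
  simp only [spread, Matrix.smul_apply, Matrix.sum_apply, conj_tupleIsometry_apply]
  rw [Finset.sum_eq_zero, smul_zero]
  intro π _
  refine Finset.sum_eq_zero fun κ _ => Finset.sum_eq_zero fun κ' _ => ?_
  split_ifs with hxy
  · obtain ⟨rfl, rfl⟩ := hxy
    exact hM κ κ' fun hκ => h ((π.injective.comp he).comp hκ)
  · rfl

end Spread

/-! ### Rigidity of type-invariant matrices on distinct tuples. -/

section SymmetricMatrices

variable {ι : Type} [Fintype ι] [DecidableEq ι] {t : ℕ}

theorem exists_perm_comp_eq {x y : Fin t → ι} (hx : Function.Injective x)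
    (hy : Function.Injective y) : ∃ σ : Equiv.Perm ι, σ ∘ x = y := by
  refine ⟨((Equiv.ofInjective x hx).symm.trans (Equiv.ofInjective y hy)).extendSubtype, ?_⟩
  ext i
  rw [Function.comp_apply, Equiv.extendSubtype_apply_of_mem _ _ (Set.mem_range_self i)]
  simp

/-- Invariance under relabelling and under permuting copies, with no coherence between a tuple of
distinct basis elements and a tuple missing one of them. -/
structure IsTypeInvariant (M : Matrix (Fin t → ι) (Fin t → ι) ℂ) : Prop where
  comp_perm : ∀ x y (τ : Equiv.Perm (Fin t)), M x (y ∘ τ) = M x y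
  relabel : ∀ (σ : Equiv.Perm ι) x y, M (σ ∘ x) (σ ∘ y) = M x y
  eq_zero : ∀ x y (i₀ : Fin t), Function.Injective x → (∀ j, y j ≠ x i₀) → M x y = 0

open Classical in
/-- The part of the trace carried by tuples of distinct basis elements. -/
noncomputable def injTrace (M : Matrix (Fin t → ι) (Fin t → ι) ℂ) : ℂ :=
  ∑ x : Fin t → ι, if Function.Injective x then M x x else 0

/-- On an injective row `x` the entry vanishes unless `y` permutes `x`, and then equals the diagonal
entry. Relabelling acts transitively on injective tuples, so that diagonal entry is one constant and
two such matrices are proportional there. -/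
theorem IsTypeInvariant.injTrace_mul_apply {M M' : Matrix (Fin t → ι) (Fin t → ι) ℂ}
    (hM : IsTypeInvariant M) (hM' : IsTypeInvariant M') {x : Fin t → ι}
    (hx : Function.Injective x) (y : Fin t → ι) :
    injTrace M * M' x y = injTrace M' * M x y := by
  classical
  have hconst : ∀ {P : Matrix (Fin t → ι) (Fin t → ι) ℂ}, IsTypeInvariant P →
      injTrace P = (Finset.univ.filter fun z : Fin t → ι => Function.Injective z).card *
        P x x := by
    intro P hP
    rw [injTrace, ← Finset.sum_filter, ← nsmul_eq_mul]
    refine Finset.sum_eq_card_nsmul fun z hz => ?_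
    obtain ⟨σ, rfl⟩ := exists_perm_comp_eq hx (Finset.mem_filter.1 hz).2
    exact hP.relabel σ x x
  rw [hconst hM, hconst hM']
  by_cases hy : ∀ i, ∃ j, y j = x i
  · obtain ⟨τ, hτ⟩ := exists_perm_of_range_subset hx hy
    have hyx : y = x ∘ τ.symm := by
      ext i
      rw [Function.comp_apply, ← hτ, Equiv.apply_symm_apply]
    rw [hyx, hM.comp_perm, hM'.comp_perm]
    ring
  · push Not at hy
    obtain ⟨i₀, h⟩ := hy
    rw [hM.eq_zero x y i₀ hx h, hM'.eq_zero x y i₀ hx h]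
    ring

open scoped ComplexOrder

open Classical in
/-- The compression of a matrix to the coordinates satisfying `p`. -/
noncomputable def compress {T : Type} (p : T → Prop) (M : Matrix T T ℂ) : Matrix T T ℂ :=
  Matrix.of fun x y => if p x ∧ p y then M x y else 0

theorem posSemidef_compress {T : Type} [Fintype T] (p : T → Prop) {M : Matrix T T ℂ}
    (hM : M.PosSemidef) : (compress p M).PosSemidef := by
  classical
  have h : compress p M = (Matrix.diagonal fun x => if p x then (1 : ℂ) else 0) * M *
      (Matrix.diagonal fun x => if p x then (1 : ℂ) else 0).conjTranspose := by
    ext x y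
    rw [Matrix.diagonal_conjTranspose, Matrix.mul_diagonal, Matrix.diagonal_mul]
    by_cases hx : p x <;> by_cases hy : p y <;> simp [compress, hx, hy]
  rw [h]
  exact hM.mul_mul_conjTranspose_same _

/-- No coherence links injective and non-injective tuples, so the difference is block diagonal. On
the injective block proportionality makes it `(1 - D.trace) • H`; on the other it is `H` itself. -/
theorem posSemidef_sub_injTrace_smul {H D : Matrix (Fin t → ι) (Fin t → ι) ℂ}
    (hH : IsTypeInvariant H) (hD : IsTypeInvariant D) (hpos : H.PosSemidef)
    (hD0 : ∀ x y, ¬Function.Injective x → D x y = 0) (hDtr : D.trace ≤ 1) :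
    (H - injTrace H • D).PosSemidef := by
  have htr : injTrace D = D.trace := by
    refine Finset.sum_congr rfl fun x _ => ?_
    split_ifs with hx
    · rfl
    · exact (hD0 x x hx).symm
  have hnot : ∀ x y : Fin t → ι, Function.Injective x → ¬Function.Injective y →
      ∃ i₀, ∀ j, y j ≠ x i₀ := by
    intro x y hx hy
    by_contra hcon
    push Not at hcon
    exact hy (injective_of_range_subset hx hcon)
  have h : H - injTrace H • D = (1 - D.trace) • compress Function.Injective H +
      compress (fun x => ¬Function.Injective x) H := by
    ext x y
    simp only [Matrix.sub_apply, Matrix.smul_apply, Matrix.add_apply, smul_eq_mul, compress,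
      Matrix.of_apply]
    by_cases hx : Function.Injective x
    · rw [hH.injTrace_mul_apply hD hx, htr]
      by_cases hy : Function.Injective y
      · simp [hx, hy]
        ring
      · obtain ⟨i₀, hi⟩ := hnot x y hx hy
        simp [hx, hy, hH.eq_zero x y i₀ hx hi]
    · rw [hD0 x y hx]
      by_cases hy : Function.Injective y
      · obtain ⟨i₀, hi⟩ := hnot y x hy hx
        have : H x y = 0 := by
          rw [← hpos.1.apply x y, hH.eq_zero y x i₀ hy hi, star_zero]
        simp [hx, this]
      · simp [hx, hy]
  rw [h]
  exact ((posSemidef_compress _ hpos).smul (sub_nonneg.2 hDtr)).add (posSemidef_compress _ hpos)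

theorem isTypeInvariant_haarAverage : IsTypeInvariant (haarAverage ι t) where
  comp_perm := haarAverage_comp_perm
  relabel := haarAverage_relabel
  eq_zero := fun _ _ i₀ hx hy => haarAverage_eq_zero_of_notMem_range hx i₀ hy

theorem one_sub_le_injTrace_haarAverage [Nonempty ι] :
    ∃ r : ℝ, injTrace (haarAverage ι t) = ((1 - r : ℝ) : ℂ) ∧ 0 ≤ r ∧ r ≤ 1 ∧
      r ≤ (t : ℝ) ^ 2 * (2 / (Fintype.card ι + 1)) := by
  classical
  have hnn : ∀ x : Fin t → ι, 0 ≤ haarAverage ι t x x :=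
    fun x => (posSemidef_haarAverage t).diag_nonneg
  have hre : ∀ x : Fin t → ι, haarAverage ι t x x = ((haarAverage ι t x x).re : ℂ) :=
    fun x => Complex.ext rfl (Complex.nonneg_iff.1 (hnn x)).2.symm
  have hnn' : ∀ x : Fin t → ι, 0 ≤ (haarAverage ι t x x).re :=
    fun x => (Complex.nonneg_iff.1 (hnn x)).1
  have htot : (∑ x : Fin t → ι, if Function.Injective x then (haarAverage ι t x x).re else 0) +
      ∑ x : Fin t → ι, (if Function.Injective x then 0 else (haarAverage ι t x x).re) = 1 := by
    have h := congrArg Complex.re (trace_haarAverage (ι := ι) t)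
    rw [Matrix.trace, Complex.re_sum, Complex.one_re] at h
    rw [← h, ← Finset.sum_add_distrib]
    refine Finset.sum_congr rfl fun x _ => ?_
    split_ifs <;> simp
  refine ⟨∑ x : Fin t → ι, (if Function.Injective x then 0 else (haarAverage ι t x x).re),
    ?_, ?_, ?_, sum_not_injective_haarAverage_le t⟩
  · rw [← htot, add_sub_cancel_right, injTrace, Complex.ofReal_sum]
    refine Finset.sum_congr rfl fun x _ => ?_
    split_ifs
    · exact hre x
    · simp
  · refine Finset.sum_nonneg fun x _ => ?_
    split_ifs
    · exact le_rfl
    · exact hnn' x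
  · rw [← htot]
    refine le_add_of_nonneg_left (Finset.sum_nonneg fun x _ => ?_)
    split_ifs
    · exact hnn' x
    · exact le_rfl

end SymmetricMatrices

/-! ### Uniform subsets as images under a uniform permutation. -/

section UniformSubsets

variable {ι : Type} [Fintype ι] [DecidableEq ι]

theorem exists_perm_image_eq {S S' : Finset ι} (h : S.card = S'.card) :
    ∃ σ : Equiv.Perm ι, S.image σ = S' := by
  refine ⟨(Finset.equivOfCardEq h).extendSubtype, Finset.eq_of_subset_of_card_le ?_ ?_⟩
  · intro y hy
    obtain ⟨x, hx, rfl⟩ := Finset.mem_image.1 hy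
    exact Equiv.extendSubtype_mem (Finset.equivOfCardEq h) x hx
  · rw [Finset.card_image_of_injective _ (Equiv.injective _), h]

/-- Double counting of pairs (subset, permutation): the sum over permutations does not depend on the
starting subset, and each permutation only rearranges the subsets. -/
theorem subsetAverage_eq_average_perm {T : Type} (F : Finset ι → Matrix T T ℂ) (S₀ : Finset ι) :
    subsetAverage S₀.card F =
      (Fintype.card (Equiv.Perm ι) : ℂ)⁻¹ • ∑ π : Equiv.Perm ι, F (S₀.image π) := by
  have h1 : ∀ S ∈ Finset.powersetCard S₀.card (Finset.univ : Finset ι),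
      ∑ π : Equiv.Perm ι, F (S.image π) = ∑ π : Equiv.Perm ι, F (S₀.image π) := by
    intro S hS
    obtain ⟨σ, rfl⟩ := exists_perm_image_eq (Finset.mem_powersetCard.1 hS).2.symm
    refine Fintype.sum_equiv (Equiv.mulRight σ) _ _ fun π => ?_
    rw [Finset.image_image]
    rfl
  have h2 : ∀ π : Equiv.Perm ι,
      ∑ S ∈ Finset.powersetCard S₀.card (Finset.univ : Finset ι), F (S.image π) =
        ∑ S ∈ Finset.powersetCard S₀.card (Finset.univ : Finset ι), F S := by
    intro π
    refine Finset.sum_nbij' (fun S => S.image π) (fun S => S.image π.symm) ?_ ?_ ?_ ?_ ?_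
    · intro S hS
      simp only [Finset.mem_powersetCard_univ] at hS ⊢
      rw [Finset.card_image_of_injective _ π.injective, hS]
    · intro S hS
      simp only [Finset.mem_powersetCard_univ] at hS ⊢
      rw [Finset.card_image_of_injective _ π.symm.injective, hS]
    · intro S _
      simp [Finset.image_image]
    · intro S _
      simp [Finset.image_image]
    · intro S _
      rfl
  have h3 : (Fintype.card (Equiv.Perm ι) : ℂ) •
      ∑ S ∈ Finset.powersetCard S₀.card (Finset.univ : Finset ι), F S =
      (Nat.choose (Fintype.card ι) S₀.card : ℂ) • ∑ π : Equiv.Perm ι, F (S₀.image π) := by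
    have h := Finset.sum_comm (s := Finset.powersetCard S₀.card (Finset.univ : Finset ι))
      (t := (Finset.univ : Finset (Equiv.Perm ι))) (f := fun S π => F (S.image π))
    rw [Finset.sum_congr rfl h1, Finset.sum_congr rfl fun π _ => h2 π, Finset.sum_const,
      Finset.sum_const, Finset.card_powersetCard, Finset.card_univ, Finset.card_univ] at h
    rw [Nat.cast_smul_eq_nsmul, Nat.cast_smul_eq_nsmul, h]
  have hc : (Nat.choose (Fintype.card ι) S₀.card : ℂ) ≠ 0 := by
    exact_mod_cast (Nat.choose_pos (Finset.card_le_univ S₀)).ne'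
  have hp : (Fintype.card (Equiv.Perm ι) : ℂ) ≠ 0 := by exact_mod_cast Fintype.card_ne_zero
  rw [subsetAverage, inv_smul_eq_iff₀ hc, smul_comm, ← h3, inv_smul_smul₀ hp]

end UniformSubsets

/-! ### The subset-phase average as a spread of independent blocks. -/

section BlockRealization

variable {ι B : Type} [Fintype ι] [DecidableEq ι] [Fintype B] [DecidableEq B] {t : ℕ}

theorem sum_bitWeight (b : ℝ) : ∑ s, bitWeight b s = 1 := by
  simp [bitWeight]
  ring

theorem sum_biasedWeight_comp {k : B → ι} (hk : Function.Injective k) (b : ℝ)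
    (F : (B → Bool) → ℝ) :
    ∑ f : ι → Bool, biasedWeight b f * F (f ∘ k) =
      ∑ s : B → Bool, (∏ β, bitWeight b (s β)) * F s := by
  classical
  have hfib : ∀ s : B → Bool,
      ∑ f : ι → Bool, (if f ∘ k = s then biasedWeight b f else 0) = ∏ β, bitWeight b (s β) := by
    intro s
    -- The constraint on `f` is distributed over the points of `ι`, so the sum factorizes: points
    -- outside the range of `k` contribute total mass 1.
    have h1 : ∀ f : ι → Bool, (if f ∘ k = s then biasedWeight b f else 0) =
        ∏ x, if ∀ β, k β = x → f x = s β then bitWeight b (f x) else 0 := by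
      intro f
      by_cases hf : f ∘ k = s
      · rw [if_pos hf]
        refine Finset.prod_congr rfl fun x _ => (if_pos ?_).symm
        rintro β rfl
        exact congrFun hf β
      · rw [if_neg hf]
        obtain ⟨β, hβ⟩ := Function.ne_iff.1 hf
        refine (Finset.prod_eq_zero (Finset.mem_univ (k β)) ?_).symm
        exact if_neg fun h => hβ (h β rfl)
    rw [Finset.sum_congr rfl fun f _ => h1 f, ← Fintype.prod_sum fun (x : ι) (v : Bool) =>
      if ∀ β, k β = x → v = s β then bitWeight b v else 0]
    refine (Fintype.prod_of_injective k hk _ _ (fun x hx => ?_) fun β => ?_).symm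
    · rw [← sum_bitWeight b]
      refine Finset.sum_congr rfl fun v _ => if_pos ?_
      rintro β rfl
      exact absurd (Set.mem_range_self β) hx
    · rw [Finset.sum_eq_single_of_mem (s β) (Finset.mem_univ _)]
      · rw [if_pos fun β' h => by rw [hk h]]
      · intro v _ hv
        exact if_neg fun h => hv (h β rfl)
  simp_rw [← hfib, Finset.sum_mul]
  rw [Finset.sum_comm]
  refine Finset.sum_congr rfl fun f _ => ?_
  rw [Finset.sum_eq_single_of_mem (f ∘ k) (Finset.mem_univ _)]
  · rw [if_pos rfl]
  · intro s _ hs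
    rw [if_neg hs.symm, zero_mul]

/-- The unnormalized amplitudes of the `t`-fold power of `∑ β, (-1)^{s β} |k β⟩`. -/
def signAmp (k : B → ι) (s : B → Bool) (x : Fin t → ι) : ℝ :=
  ∏ i, ∑ β, if x i = k β then boolSign (s β) else 0

omit [DecidableEq B] in
theorem subsetPhaseState_image_apply {k : B → ι} (hk : Function.Injective k)
    (f : ι → Bool) (x : ι) :
    subsetPhaseState (Finset.univ.image k) f x =
      ((1 / √(Fintype.card B : ℝ) * ∑ β, if x = k β then boolSign (f (k β)) else 0 : ℝ) : ℂ) := by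
  change (if x ∈ Finset.univ.image k then _ else _) = _
  rw [Finset.card_image_of_injective _ hk, Finset.card_univ]
  by_cases hx : ∃ β, k β = x
  · obtain ⟨β, rfl⟩ := hx
    rw [if_pos (Finset.mem_image_of_mem k (Finset.mem_univ β)),
      Finset.sum_eq_single_of_mem β (Finset.mem_univ β)
        fun β' _ hβ' => if_neg fun h => hβ' (hk h).symm, if_pos rfl]
    simp [boolSign]
  · rw [if_neg (by simpa using hx), Finset.sum_eq_zero fun β _ => if_neg fun h => hx ⟨β, h.symm⟩]
    simp

omit [DecidableEq B] in
theorem dyadTensorPower_subsetPhaseState_image {k : B → ι}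
    (hk : Function.Injective k) (f : ι → Bool) (x y : Fin t → ι) :
    dyadTensorPower t (subsetPhaseState (Finset.univ.image k) f) x y =
      (((Fintype.card B : ℝ)⁻¹ ^ t * (signAmp k (f ∘ k) x * signAmp k (f ∘ k) y) : ℝ) : ℂ) := by
  have hsq : (1 / √(Fintype.card B : ℝ)) * (1 / √(Fintype.card B : ℝ)) =
      (Fintype.card B : ℝ)⁻¹ := by
    rw [div_mul_div_comm, one_mul, Real.mul_self_sqrt (Nat.cast_nonneg _), one_div]
  simp only [dyadTensorPower, Matrix.of_apply, subsetPhaseState_image_apply hk,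
    Complex.star_def, Complex.conj_ofReal]
  rw [Finset.prod_congr rfl fun i _ => (Complex.ofReal_mul _ _).symm, ← Complex.ofReal_prod]
  congr 1
  rw [Finset.prod_mul_distrib, Finset.prod_mul_distrib, Finset.prod_mul_distrib,
    Finset.prod_const, Finset.card_univ, Fintype.card_fin, mul_mul_mul_comm, ← mul_pow, hsq]
  rfl

/-- The second moment of the sign amplitudes over i.i.d. biased bits. -/
noncomputable def signMoment (t : ℕ) (b : ℝ) (k : B → ι) : Matrix (Fin t → ι) (Fin t → ι) ℂ :=
  gramMatrix (fun s : B → Bool => ∏ β, bitWeight b (s β)) (signAmp k)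

theorem sum_biasedWeight_smul_dyadTensorPower (b : ℝ) {k : B → ι}
    (hk : Function.Injective k) :
    ∑ f : ι → Bool, (biasedWeight b f : ℂ) •
        dyadTensorPower t (subsetPhaseState (Finset.univ.image k) f) =
      ((Fintype.card B : ℂ)⁻¹ ^ t) • signMoment t b k := by
  ext x y
  simp only [Matrix.sum_apply, Matrix.smul_apply, smul_eq_mul, signMoment, gramMatrix,
    Matrix.of_apply, dyadTensorPower_subsetPhaseState_image hk]
  rw [← sum_biasedWeight_comp hk b fun s => signAmp k s x * signAmp k s y, Complex.ofReal_sum,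
    Finset.mul_sum]
  refine Finset.sum_congr rfl fun f _ => ?_
  push_cast
  ring

variable {Λ : Type} [Fintype Λ] [DecidableEq Λ]

omit [Fintype ι] [DecidableEq B] in
theorem sum_prodAmp_blockAmp (j : B × Λ → ι) (ω : B → Λ × Bool × Bool) (x : Fin t → ι) :
    ∑ κ : Fin t → B × Λ, (if x = j ∘ κ then prodAmp blockAmp ω κ else 0) =
      signAmp (fun β => j (β, (ω β).1)) (fun β => (ω β).2.1) x := by
  have h : ∀ κ : Fin t → B × Λ, (if x = j ∘ κ then prodAmp blockAmp ω κ else 0) =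
      ∏ i, if x i = j (κ i) then blockAmp (ω (κ i).1) (κ i).2 else 0 := by
    intro κ
    split_ifs with hx
    · subst hx
      simp [prodAmp]
    · obtain ⟨i, hi⟩ := Function.ne_iff.1 hx
      exact (Finset.prod_eq_zero (Finset.mem_univ i) (if_neg hi)).symm
  rw [Finset.sum_congr rfl fun κ _ => h κ, ← Fintype.prod_sum fun (i : Fin t) (p : B × Λ) =>
    if x i = j p then blockAmp (ω p.1) p.2 else 0]
  refine Finset.prod_congr rfl fun i _ => ?_
  rw [Fintype.sum_prod_type]
  refine Finset.sum_congr rfl fun β _ => ?_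
  rw [Finset.sum_eq_single_of_mem (ω β).1 (Finset.mem_univ _)]
  · simp [blockAmp]
  · intro l _ hl
    simp [blockAmp, hl.symm]

omit [DecidableEq Λ] in
theorem sum_blockWeight_prod (b : ℝ) (G : (B → Λ) → (B → Bool) → ℝ) :
    ∑ ω : B → Λ × Bool × Bool, (∏ β, blockWeight b (ω β)) *
        G (fun β => (ω β).1) (fun β => (ω β).2.1) =
      ((Fintype.card Λ : ℝ)⁻¹ ^ Fintype.card B) *
        ∑ c : B → Λ, ∑ s : B → Bool, (∏ β, bitWeight b (s β)) * G c s := by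
  have h1 : ∑ ω : B → Λ × Bool × Bool, (∏ β, blockWeight b (ω β)) *
      G (fun β => (ω β).1) (fun β => (ω β).2.1) =
      ∑ p : (B → Λ) × (B → Bool) × (B → Bool),
        (∏ β, (Fintype.card Λ : ℝ)⁻¹ * (bitWeight b (p.2.1 β) * (1 / 2))) * G p.1 p.2.1 := by
    refine Fintype.sum_equiv ((Equiv.arrowProdEquivProdArrow B (fun _ => Λ)
      (fun _ => Bool × Bool)).trans (Equiv.prodCongr (Equiv.refl _)
        (Equiv.arrowProdEquivProdArrow B (fun _ => Bool) (fun _ => Bool)))) _ _ fun ω => rfl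
  rw [h1, Fintype.sum_prod_type, Finset.mul_sum]
  refine Finset.sum_congr rfl fun c _ => ?_
  rw [Fintype.sum_prod_type, Finset.mul_sum]
  refine Finset.sum_congr rfl fun s _ => ?_
  simp only [Finset.prod_mul_distrib, Finset.prod_const, Finset.card_univ, Finset.sum_const,
    Fintype.card_fun, Fintype.card_bool, nsmul_eq_mul]
  push_cast
  -- The auxiliary fair bits do not enter `G` and sum out to 1.
  have : (2 : ℝ) ^ Fintype.card B * (1 / 2) ^ Fintype.card B = 1 := by
    rw [← mul_pow]; norm_num
  linear_combination ((Fintype.card Λ : ℝ)⁻¹ ^ Fintype.card B * (∏ β, bitWeight b (s β)) *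
    G c s) * this

omit [Fintype ι] in
theorem conj_tupleIsometry_gramMatrix (b : ℝ) (j : B × Λ → ι) :
    tupleIsometry t j * gramMatrix (T := Fin t → B × Λ) (fun ω : B → Λ × Bool × Bool => ∏ β,
        blockWeight b (ω β)) (prodAmp blockAmp) * (tupleIsometry t j).conjTranspose =
      ((Fintype.card Λ : ℂ)⁻¹ ^ Fintype.card B) •
        ∑ c : B → Λ, signMoment t b fun β => j (β, c β) := by
  ext x y
  rw [conj_tupleIsometry_apply]
  simp only [Matrix.smul_apply, Matrix.sum_apply, signMoment, gramMatrix, Matrix.of_apply,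
    smul_eq_mul]
  have h := sum_blockWeight_prod b fun (c : B → Λ) (s : B → Bool) =>
    signAmp (fun β => j (β, c β)) s x * signAmp (fun β => j (β, c β)) s y
  have h' := congrArg (fun r : ℝ => (r : ℂ)) h
  simp only [Complex.ofReal_mul, Complex.ofReal_pow, Complex.ofReal_inv, Complex.ofReal_natCast,
    Complex.ofReal_sum] at h' ⊢
  rw [← h']
  simp only [← Complex.ofReal_mul, ← Complex.ofReal_sum]
  have hsum : ∑ κ : Fin t → B × Λ, ∑ κ' : Fin t → B × Λ, (if x = j ∘ κ ∧ y = j ∘ κ' then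
      ∑ ω : B → Λ × Bool × Bool, (∏ β, blockWeight b (ω β)) *
        (prodAmp blockAmp ω κ * prodAmp blockAmp ω κ') else 0) =
      ∑ ω : B → Λ × Bool × Bool, (∏ β, blockWeight b (ω β)) *
        (signAmp (fun β => j (β, (ω β).1)) (fun β => (ω β).2.1) x *
          signAmp (fun β => j (β, (ω β).1)) (fun β => (ω β).2.1) y) := by
    have hterm : ∀ κ κ' : Fin t → B × Λ, (if x = j ∘ κ ∧ y = j ∘ κ' then
        ∑ ω : B → Λ × Bool × Bool, (∏ β, blockWeight b (ω β)) *
          (prodAmp blockAmp ω κ * prodAmp blockAmp ω κ') else 0) =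
        ∑ ω : B → Λ × Bool × Bool, (∏ β, blockWeight b (ω β)) *
          ((if x = j ∘ κ then prodAmp blockAmp ω κ else 0) *
            (if y = j ∘ κ' then prodAmp blockAmp ω κ' else 0)) := by
      intro κ κ'
      by_cases hx : x = j ∘ κ <;> by_cases hy : y = j ∘ κ' <;> simp [hx, hy]
    simp_rw [hterm]
    rw [Finset.sum_congr rfl fun κ _ => Finset.sum_comm, Finset.sum_comm]
    refine Finset.sum_congr rfl fun ω _ => ?_
    rw [← sum_prodAmp_blockAmp, ← sum_prodAmp_blockAmp, Finset.sum_mul_sum, Finset.mul_sum]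
    refine Finset.sum_congr rfl fun κ _ => ?_
    rw [Finset.mul_sum]
  rw [← hsum, Complex.ofReal_sum]
  refine Finset.sum_congr rfl fun κ _ => ?_
  rw [Complex.ofReal_sum]
  refine Finset.sum_congr rfl fun κ' _ => ?_
  split_ifs <;> simp

/-- For each fixed choice `c` of one element per block, the random permutation already yields a
uniform subset, so averaging over `c` as well changes nothing. The average over `c` makes the block
amplitudes independent with spread-out means. -/
theorem biasedSubsetPhaseAverage_eq_spread [Nonempty Λ] (b : ℝ) {e : B × Λ → ι}
    (he : Function.Injective e) :
    biasedSubsetPhaseAverage ι t (Fintype.card B) b =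
      ((Fintype.card B : ℂ)⁻¹ ^ t) • spread e
        (gramMatrix (T := Fin t → B × Λ) (fun ω : B → Λ × Bool × Bool => ∏ β, blockWeight b (ω β))
          (prodAmp blockAmp)) := by
  set Φ : Finset ι → Matrix (Fin t → ι) (Fin t → ι) ℂ := fun S =>
    ∑ f : ι → Bool, (biasedWeight b f : ℂ) • dyadTensorPower t (subsetPhaseState S f) with hΦ
  have hinj : ∀ c : B → Λ, Function.Injective fun β => e (β, c β) := fun c β β' h =>
    congrArg Prod.fst (he h)
  have hρ : ∀ c : B → Λ, (Fintype.card (Equiv.Perm ι) : ℂ)⁻¹ • ∑ π : Equiv.Perm ι,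
      ((Fintype.card B : ℂ)⁻¹ ^ t) • signMoment t b (fun β => (π ∘ e) (β, c β)) =
      biasedSubsetPhaseAverage ι t (Fintype.card B) b := by
    intro c
    have hcard : (Finset.univ.image fun β => e (β, c β)).card = Fintype.card B := by
      rw [Finset.card_image_of_injective _ (hinj c), Finset.card_univ]
    have h := subsetAverage_eq_average_perm Φ (Finset.univ.image fun β => e (β, c β))
    rw [hcard] at h
    rw [biasedSubsetPhaseAverage, h]
    congr 1
    refine Finset.sum_congr rfl fun π _ => ?_
    rw [Finset.image_image]
    exact (sum_biasedWeight_smul_dyadTensorPower b (π.injective.comp (hinj c))).symm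
  have hΛ : (Fintype.card Λ : ℂ) ≠ 0 := by exact_mod_cast Fintype.card_ne_zero
  calc biasedSubsetPhaseAverage ι t (Fintype.card B) b
      = ((Fintype.card Λ : ℂ)⁻¹ ^ Fintype.card B) • ∑ _c : B → Λ,
          biasedSubsetPhaseAverage ι t (Fintype.card B) b := by
        rw [Finset.sum_const, Finset.card_univ, Fintype.card_fun, ← Nat.cast_smul_eq_nsmul ℂ,
          smul_smul, Nat.cast_pow, ← mul_pow, inv_mul_cancel₀ hΛ, one_pow, one_smul]
    _ = _ := by
        rw [Finset.sum_congr rfl fun c _ => (hρ c).symm, spread]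
        simp only [conj_tupleIsometry_gramMatrix, ← Finset.smul_sum]
        rw [Finset.sum_comm]
        simp only [smul_smul]
        congr 1
        ring

end BlockRealization

/-! ### The common lower bound and the quantitative estimate. -/

section CommonLowerBound

open scoped ComplexOrder

variable {ι B Λ : Type} [Fintype ι] [DecidableEq ι] [Fintype B] [DecidableEq B] [Fintype Λ]
  [DecidableEq Λ] {t : ℕ}

theorem spread_smul {K : Type} [Fintype K] {e : K → ι} (c : ℂ)
    (M : Matrix (Fin t → K) (Fin t → K) ℂ) : spread e (c • M) = c • spread e M := by
  simp only [spread, Matrix.mul_smul, Matrix.smul_mul, ← Finset.smul_sum]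
  rw [smul_comm]

/-- The normalized second-moment matrix of a family of amplitudes over independent blocks. -/
noncomputable def blockMoment (t : ℕ) (b : ℝ)
    (P : (B → Λ × Bool × Bool) → (Fin t → B × Λ) → ℝ) :
    Matrix (Fin t → B × Λ) (Fin t → B × Λ) ℂ :=
  ((Fintype.card B : ℂ)⁻¹ ^ t) •
    gramMatrix (fun ω : B → Λ × Bool × Bool => ∏ β, blockWeight b (ω β)) P

omit [DecidableEq Λ] in
theorem blockMoment_apply (b : ℝ) (P : (B → Λ × Bool × Bool) → (Fin t → B × Λ) → ℝ)
    (κ κ' : Fin t → B × Λ) :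
    blockMoment t b P κ κ' = (Fintype.card B : ℂ)⁻¹ ^ t *
      ((∑ ω : B → Λ × Bool × Bool, (∏ β, blockWeight b (ω β)) * (P ω κ * P ω κ') : ℝ) : ℂ) :=
  rfl

omit [DecidableEq B] in
theorem inv_card_pow_nonneg : (0 : ℂ) ≤ (Fintype.card B : ℂ)⁻¹ ^ t :=
  pow_nonneg (inv_nonneg.2 (Nat.cast_nonneg _)) _

omit [DecidableEq Λ] in
theorem posSemidef_blockMoment {b : ℝ} (hb : b ∈ Set.Icc (-1 : ℝ) 1)
    (P : (B → Λ × Bool × Bool) → (Fin t → B × Λ) → ℝ) : (blockMoment t b P).PosSemidef :=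
  (posSemidef_gramMatrix fun _ => Finset.prod_nonneg fun _ _ => blockWeight_nonneg hb _).smul
    inv_card_pow_nonneg

omit [DecidableEq Λ] in
theorem posSemidef_blockMoment_sub {b : ℝ} (hb : b ∈ Set.Icc (-1 : ℝ) 1)
    {P Z : (B → Λ × Bool × Bool) → (Fin t → B × Λ) → ℝ}
    (h : ∀ κ κ', ∑ ω, (∏ β, blockWeight b (ω β)) * (Z ω κ * P ω κ') =
      ∑ ω, (∏ β, blockWeight b (ω β)) * (Z ω κ * Z ω κ')) :
    (blockMoment t b P - blockMoment t b Z).PosSemidef := by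
  rw [blockMoment, blockMoment, ← smul_sub, gramMatrix_sub_of_orthogonal h]
  exact posSemidef_blockMoment hb _

variable [Nonempty Λ]

theorem posSemidef_blockAmp_sub_centredAmp {b : ℝ} (hb : b ∈ Set.Icc (-1 : ℝ) 1) :
    (blockMoment t b (B := B) (Λ := Λ) (prodAmp blockAmp) -
      blockMoment t b (injAmp (centredAmp b))).PosSemidef :=
  posSemidef_blockMoment_sub hb fun κ κ' =>
    sum_injAmp_mul_prodAmp (sum_centredAmp b) (sum_centredAmp_mul_blockAmp b) κ κ'

theorem posSemidef_decorrelatedAmp_sub_centredAmp {b : ℝ} (hb : b ∈ Set.Icc (-1 : ℝ) 1) :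
    (blockMoment t b (B := B) (Λ := Λ) (injAmp (decorrelatedAmp b)) -
      blockMoment t b (injAmp (centredAmp b))).PosSemidef :=
  posSemidef_blockMoment_sub hb fun κ κ' =>
    -- Two uses of the same identity: one extends the decorrelated amplitude from distinct blocks to
    -- all tuples, the other projects it onto the centred one.
    (sum_injAmp_mul_prodAmp (F' := decorrelatedAmp b) (sum_centredAmp b)
      (fun _ _ => rfl) κ κ').symm.trans
    (sum_injAmp_mul_prodAmp (sum_centredAmp b) (sum_centredAmp_mul_decorrelatedAmp b) κ κ')

open Classical in
/-- The probability that `t` independent uniform blocks are distinct. -/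
noncomputable def distinctProb (B : Type) [Fintype B] (t : ℕ) : ℝ :=
  ∑ β : Fin t → B, if Function.Injective β then (Fintype.card B : ℝ)⁻¹ ^ t else 0

omit [DecidableEq Λ] in
theorem trace_blockMoment_injAmp {b v : ℝ} {Y : Λ × Bool × Bool → Λ → ℝ}
    (hv : ∀ l, ∑ a, blockWeight b a * (Y a l * Y a l) = (Fintype.card Λ : ℝ)⁻¹ * v) :
    (blockMoment t b (B := B) (injAmp Y)).trace = ((distinctProb B t * v ^ t : ℝ) : ℂ) := by
  classical
  have hdiag : ∀ κ : Fin t → B × Λ, blockMoment t b (injAmp Y) κ κ =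
      (((if Function.Injective fun i => (κ i).1 then (Fintype.card B : ℝ)⁻¹ ^ t else 0) *
        ((Fintype.card Λ : ℝ)⁻¹ * v) ^ t : ℝ) : ℂ) := by
    intro κ
    rw [blockMoment_apply]
    split_ifs with hκ
    · rw [sum_injAmp_sq (sum_blockWeight b) hv hκ]
      push_cast
      ring
    · simp [injAmp_of_not_injective hκ]
  -- Distinctness concerns only the blocks; the free positions inside them give `|Λ| ^ t`, which
  -- cancels the variance normalization.
  have hsum : ∑ κ : Fin t → B × Λ,
      (if Function.Injective fun i => (κ i).1 then (Fintype.card B : ℝ)⁻¹ ^ t else 0) =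
      (Fintype.card Λ : ℝ) ^ t * distinctProb B t := by
    have h : ∑ κ : Fin t → B × Λ,
        (if Function.Injective fun i => (κ i).1 then (Fintype.card B : ℝ)⁻¹ ^ t else 0) =
        ∑ p : (Fin t → B) × (Fin t → Λ),
          if Function.Injective p.1 then (Fintype.card B : ℝ)⁻¹ ^ t else 0 :=
      Fintype.sum_equiv (Equiv.arrowProdEquivProdArrow (Fin t) (fun _ => B) (fun _ => Λ))
        _ _ fun κ => rfl
    rw [h, Fintype.sum_prod_type, distinctProb, Finset.mul_sum]
    refine Finset.sum_congr rfl fun β _ => ?_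
    simp
  have hΛ : (Fintype.card Λ : ℝ) ≠ 0 := by exact_mod_cast Fintype.card_ne_zero
  rw [Matrix.trace]
  simp only [Matrix.diag_apply, hdiag]
  rw [← Complex.ofReal_sum, ← Finset.sum_mul, hsum, mul_pow, mul_mul_mul_comm, ← mul_pow,
    mul_inv_cancel₀ hΛ, one_pow, one_mul]

theorem trace_blockMoment_blockAmp [Nonempty B] (b : ℝ) :
    (blockMoment t b (B := B) (Λ := Λ) (prodAmp blockAmp)).trace = 1 := by
  have hB : (Fintype.card B : ℝ) ≠ 0 := by exact_mod_cast Fintype.card_ne_zero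
  have hone : ∑ ω : B → Λ × Bool × Bool, (∏ β, blockWeight b (ω β)) = 1 := by
    rw [← Fintype.prod_sum fun (_ : B) (a : Λ × Bool × Bool) => blockWeight b a]
    simp [sum_blockWeight]
  have hsq : ∀ ω : B → Λ × Bool × Bool, ∑ κ : Fin t → B × Λ,
      prodAmp blockAmp ω κ * prodAmp blockAmp ω κ = (Fintype.card B : ℝ) ^ t := by
    intro ω
    simp only [prodAmp, ← Finset.prod_mul_distrib]
    rw [← Fintype.prod_sum fun (_ : Fin t) (p : B × Λ) =>
      blockAmp (ω p.1) p.2 * blockAmp (ω p.1) p.2]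
    have h1 : ∀ a : Λ × Bool × Bool, ∑ l, blockAmp a l * blockAmp a l = 1 := by
      intro a
      rw [Finset.sum_eq_single_of_mem a.1 (Finset.mem_univ _)
        fun l _ hl => by simp [blockAmp, hl.symm]]
      rcases a with ⟨c, s, g⟩
      cases s <;> simp [blockAmp, boolSign]
    simp [Fintype.sum_prod_type, h1]
  rw [Matrix.trace]
  simp only [Matrix.diag_apply, blockMoment_apply]
  rw [← Finset.mul_sum, ← Complex.ofReal_sum, Finset.sum_comm]
  simp only [← Finset.mul_sum, hsq]
  rw [← Finset.sum_mul, hone]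
  push_cast
  rw [one_mul, ← mul_pow, inv_mul_cancel₀ (by exact_mod_cast hB), one_pow]

theorem isTypeInvariant_spread_decorrelatedAmp {e : B × Λ → ι} (b : ℝ) :
    IsTypeInvariant (spread e (blockMoment t b (injAmp (decorrelatedAmp b)))) where
  comp_perm := spread_comp_perm fun κ κ' τ => by
    simp only [blockMoment_apply, injAmp_comp_perm]
  relabel := spread_relabel
  eq_zero := fun x y i₀ _ h => spread_eq_zero_of_notMem (fun κ κ' i₀ hκ => by
    rw [blockMoment_apply, sum_injAmp_mul_injAmp_eq_zero (sum_decorrelatedAmp b)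
      (fun l l' hl => by rw [sum_decorrelatedAmp_mul, if_neg hl]) i₀ hκ]
    simp) i₀ h

theorem distinctProb_le_one [Nonempty B] : distinctProb B t ≤ 1 := by
  classical
  have hB : (Fintype.card B : ℝ) ≠ 0 := by exact_mod_cast Fintype.card_ne_zero
  calc distinctProb B t ≤ ∑ _β : Fin t → B, (Fintype.card B : ℝ)⁻¹ ^ t := by
        refine Finset.sum_le_sum fun β _ => ?_
        split_ifs
        · exact le_rfl
        · positivity
    _ = 1 := by simp [hB]

theorem one_sub_le_distinctProb [Nonempty B] :
    1 - (t : ℝ) ^ 2 / Fintype.card B ≤ distinctProb B t := by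
  classical
  have hB : (Fintype.card B : ℝ) ≠ 0 := by exact_mod_cast Fintype.card_ne_zero
  have h := sum_not_injective_prod_le t (fun _ : B => (Fintype.card B : ℝ)⁻¹)
    (fun _ => by positivity) (by simp [hB])
  have htot : distinctProb B t + ∑ β : Fin t → B,
      (if Function.Injective β then 0 else ∏ _i : Fin t, (Fintype.card B : ℝ)⁻¹) = 1 := by
    rw [distinctProb, ← Finset.sum_add_distrib]
    rw [Finset.sum_congr rfl fun β _ => show _ = (Fintype.card B : ℝ)⁻¹ ^ t by
      split_ifs <;> simp]
    simp [hB]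
  have hr : (t : ℝ) ^ 2 * ∑ _a : B, (Fintype.card B : ℝ)⁻¹ ^ 2 = (t : ℝ) ^ 2 / Fintype.card B := by
    simp
    field_simp
  linarith

theorem traceDistance_le_of_blocks [Nonempty B] [Nonempty ι] {b : ℝ}
    (hb : b ∈ Set.Icc (-1 : ℝ) 1) {e : B × Λ → ι} (he : Function.Injective e) :
    traceDistance (biasedSubsetPhaseAverage ι t (Fintype.card B) b) (haarAverage ι t) ≤
      (t : ℝ) ^ 2 * (2 / (Fintype.card ι + 1)) + (t : ℝ) ^ 2 / Fintype.card B +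
        t * (b ^ 2 / Fintype.card Λ) := by
  set R : Matrix (Fin t → ι) (Fin t → ι) ℂ :=
    spread e (blockMoment t b (prodAmp blockAmp)) with hR
  set D : Matrix (Fin t → ι) (Fin t → ι) ℂ :=
    spread e (blockMoment t b (injAmp (decorrelatedAmp b))) with hD
  set G : Matrix (Fin t → ι) (Fin t → ι) ℂ :=
    spread e (blockMoment t b (injAmp (centredAmp b))) with hG
  have hρ : biasedSubsetPhaseAverage ι t (Fintype.card B) b = R := by
    rw [biasedSubsetPhaseAverage_eq_spread b he, hR, blockMoment, spread_smul]
  have hRG : (R - G).PosSemidef := by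
    rw [hR, hG, ← spread_sub]
    exact posSemidef_spread (posSemidef_blockAmp_sub_centredAmp hb)
  have hDG : (D - G).PosSemidef := by
    rw [hD, hG, ← spread_sub]
    exact posSemidef_spread (posSemidef_decorrelatedAmp_sub_centredAmp hb)
  have hGpos : G.PosSemidef := posSemidef_spread (posSemidef_blockMoment hb _)
  have hRtr : R.trace = 1 := by rw [hR, trace_spread he, trace_blockMoment_blockAmp]
  have hGtr : G.trace = ((distinctProb B t * (1 - b ^ 2 / Fintype.card Λ) ^ t : ℝ) : ℂ) := by
    rw [hG, trace_spread he, trace_blockMoment_injAmp (sum_centredAmp_sq b)]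
  have hDtr : D.trace ≤ 1 := by
    rw [hD, trace_spread he, trace_blockMoment_injAmp (v := 1) fun l => by
      rw [sum_decorrelatedAmp_mul, if_pos rfl, mul_one]]
    rw [one_pow, mul_one]
    exact_mod_cast distinctProb_le_one
  obtain ⟨r, hr, hr0, hr1, hrle⟩ := one_sub_le_injTrace_haarAverage (ι := ι) (t := t)
  have hHD := posSemidef_sub_injTrace_smul isTypeInvariant_haarAverage
    (isTypeInvariant_spread_decorrelatedAmp b) (posSemidef_haarAverage t)
    (fun x y hx => spread_eq_zero_of_not_injective (e := e) he (fun κ κ' hκ => by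
      have hκ' : ¬Function.Injective fun i => (κ i).1 := fun h =>
        hκ fun i j hij => h (congrArg Prod.fst hij)
      simp [blockMoment_apply, injAmp_of_not_injective hκ']) hx) hDtr
  rw [hr] at hHD
  -- The chain H ≥ (1 - r) D ≥ (1 - r) G.
  have hHG : (haarAverage ι t - ((1 - r : ℝ) : ℂ) • G).PosSemidef := by
    have h := hHD.add (hDG.smul (show (0 : ℂ) ≤ ((1 - r : ℝ) : ℂ) by
      exact_mod_cast sub_nonneg.2 hr1))
    rwa [smul_sub, sub_add_sub_cancel] at h
  have hRG' : (R - ((1 - r : ℝ) : ℂ) • G).PosSemidef := by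
    have h := hRG.add (hGpos.smul (show (0 : ℂ) ≤ (r : ℂ) by exact_mod_cast hr0))
    have heq : R - ((1 - r : ℝ) : ℂ) • G = R - G + (r : ℂ) • G := by
      push_cast
      module
    rwa [heq]
  have hmain := traceDistance_le_of_common_lower_bound hRG' hHG hRtr (trace_haarAverage t)
  rw [Matrix.trace_smul, hGtr, smul_eq_mul, ← Complex.ofReal_mul, Complex.ofReal_re] at hmain
  rw [hρ]
  refine hmain.trans ?_
  have hΛ : (1 : ℝ) ≤ Fintype.card Λ := by exact_mod_cast Fintype.card_pos
  have hb2 : b ^ 2 ≤ 1 := by nlinarith [hb.1, hb.2]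
  have hx0 : 0 ≤ b ^ 2 / Fintype.card Λ := by positivity
  have hx1 : b ^ 2 / Fintype.card Λ ≤ 1 := (div_le_one (by linarith)).2 (hb2.trans hΛ)
  have hq1 : (1 - b ^ 2 / Fintype.card Λ) ^ t ≤ 1 := pow_le_one₀ (by linarith) (by linarith)
  have hq0 : 0 ≤ (1 - b ^ 2 / Fintype.card Λ) ^ t := pow_nonneg (by linarith) _
  have hq : 1 - t * (b ^ 2 / Fintype.card Λ) ≤ (1 - b ^ 2 / Fintype.card Λ) ^ t := by
    have h := one_add_mul_le_pow (a := -(b ^ 2 / Fintype.card Λ)) (by linarith) t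
    rw [← sub_eq_add_neg] at h
    linarith
  have hp := one_sub_le_distinctProb (B := B) (t := t)
  have hp1 := distinctProb_le_one (B := B) (t := t)
  generalize (1 - b ^ 2 / (Fintype.card Λ : ℝ)) ^ t = q at *
  generalize distinctProb B t = p at *
  -- This is (1 - p)(1 - q) ≥ 0; then 1 - (1 - r) p q ≤ r + (1 - p) + (1 - q), so the three losses
  -- add.
  have hpq : p + q - 1 ≤ p * q := by nlinarith
  have hpq1 : p * q ≤ 1 := by nlinarith
  nlinarith

theorem traceDistance_biasedSubsetPhaseAverage_le [Nonempty ι] {m : ℕ} (hm : 0 < m)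
    (hmN : m ≤ Fintype.card ι) {b : ℝ} (hb : b ∈ Set.Icc (-1 : ℝ) 1) (t : ℕ) :
    traceDistance (biasedSubsetPhaseAverage ι t m b) (haarAverage ι t) ≤
      3 * (t * m * b ^ 2 / Fintype.card ι) + 3 * ((t : ℝ) ^ 2 / m) := by
  have hL : 0 < Fintype.card ι / m := Nat.div_pos hmN hm
  have : Nonempty (Fin m) := ⟨⟨0, hm⟩⟩
  have : Nonempty (Fin (Fintype.card ι / m)) := ⟨⟨0, hL⟩⟩
  obtain ⟨e⟩ := Function.Embedding.nonempty_of_card_le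
    (α := Fin m × Fin (Fintype.card ι / m)) (β := ι) (by
      simpa using Nat.mul_div_le (Fintype.card ι) m)
  have h := traceDistance_le_of_blocks (t := t) hb e.injective
  simp only [Fintype.card_fin] at h
  refine h.trans ?_
  have hm' : (0 : ℝ) < m := by exact_mod_cast hm
  have hmN' : (m : ℝ) ≤ Fintype.card ι := by exact_mod_cast hmN
  have hL' : (0 : ℝ) < ((Fintype.card ι / m : ℕ) : ℝ) := by exact_mod_cast hL
  -- Rounding N/m down loses at most a factor 2 because the quotient is at least 1.
  have hNL : (Fintype.card ι : ℝ) ≤ 2 * m * ((Fintype.card ι / m : ℕ) : ℝ) := by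
    have h1 := Nat.div_add_mod (Fintype.card ι) m
    have h2 := Nat.mod_lt (Fintype.card ι) hm
    have h3 : Fintype.card ι ≤ 2 * m * (Fintype.card ι / m) := by nlinarith
    exact_mod_cast h3
  -- The Haar collision term costs 2 t²/m, as m ≤ N; with t²/m from the blocks this gives the
  -- constant 3.
  have e1 : (t : ℝ) ^ 2 * (2 / (Fintype.card ι + 1)) ≤ 2 * ((t : ℝ) ^ 2 / m) := by
    rw [mul_div_assoc', mul_comm _ (2 : ℝ), mul_div_assoc]
    gcongr
    linarith
  have e2 : (t : ℝ) * (b ^ 2 / ((Fintype.card ι / m : ℕ) : ℝ)) ≤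
      2 * (t * m * b ^ 2 / Fintype.card ι) := by
    rw [mul_div_assoc', mul_div_assoc', div_le_div_iff₀ hL' (hm'.trans_le hmN')]
    have := mul_le_mul_of_nonneg_left hNL (show 0 ≤ (t : ℝ) * b ^ 2 by positivity)
    linarith
  have e3 : 0 ≤ (t : ℝ) * m * b ^ 2 / Fintype.card ι := by positivity
  linarith

end CommonLowerBound

/-! ### The endpoints b = ±1 and the midpoint b = 0. -/

section Interpolation

variable {ι : Type} [Fintype ι] [DecidableEq ι]

theorem dyadTensorPower_subsetPhaseState_const (t : ℕ) (S : Finset ι) (v : Bool) :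
    dyadTensorPower t (subsetPhaseState S fun _ => v) = dyadTensorPower t (subsetState S) := by
  ext x y
  simp only [dyadTensorPower, Matrix.of_apply]
  refine Finset.prod_congr rfl fun i _ => ?_
  cases v <;> by_cases hx : x i ∈ S <;> by_cases hy : y i ∈ S <;>
    simp [subsetPhaseState, subsetState, hx, hy]

/-- Only the constant function `v` carries mass, and a global sign disappears from the projector. -/
theorem biasedSubsetPhaseAverage_of_deterministic (t m : ℕ) {b : ℝ} (v : Bool)
    (hb : ∀ s, bitWeight b s = if s = v then 1 else 0) :
    biasedSubsetPhaseAverage ι t m b = subsetStateAverage ι t m := by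
  unfold biasedSubsetPhaseAverage subsetStateAverage
  congr 1
  ext1 S
  rw [Finset.sum_eq_single_of_mem (fun _ => v) (Finset.mem_univ _)]
  · have h : biasedWeight b (fun _ : ι => v) = 1 :=
      Finset.prod_eq_one fun x _ => (hb v).trans (if_pos rfl)
    rw [h, Complex.ofReal_one, one_smul, dyadTensorPower_subsetPhaseState_const]
  · intro f _ hf
    obtain ⟨x, hx⟩ := Function.ne_iff.1 hf
    have h : biasedWeight b f = 0 :=
      Finset.prod_eq_zero (Finset.mem_univ x) ((hb (f x)).trans (if_neg hx))
    rw [h, Complex.ofReal_zero, zero_smul]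

theorem biasedSubsetPhaseAverage_zero (t m : ℕ) :
    biasedSubsetPhaseAverage ι t m 0 = uniformSubsetPhaseAverage ι t m := by
  unfold biasedSubsetPhaseAverage uniformSubsetPhaseAverage
  congr 1
  ext1 S
  rw [Finset.smul_sum]
  refine Finset.sum_congr rfl fun f _ => ?_
  congr 1
  simp [biasedWeight]

end Interpolation

theorem mainTheorem2 :
    -- the trace-distance bound, with one absolute constant, for `N = 2 ^ n`
    (∃ C : ℝ, 0 < C ∧
      ∀ (t m : ℕ → ℕ) (b : ℕ → ℝ),
        -- `t = O(poly(n))`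
        (∃ k : ℕ, (fun n => (t n : ℝ)) =O[atTop] (fun n => (n : ℝ) ^ k)) →
        -- `m = ω(poly(n))`
        (∀ k : ℕ, (fun n : ℕ => (n : ℝ) ^ k) =o[atTop] (fun n => (m n : ℝ))) →
        -- `m = o(2 ^ n)`
        ((fun n => (m n : ℝ)) =o[atTop] (fun n : ℕ => (2 : ℝ) ^ n)) →
        (∀ n, b n ∈ Set.Icc (-1 : ℝ) 1) →
        ∀ᶠ n : ℕ in atTop,
          traceDistance (biasedSubsetPhaseAverage (Fin n → Bool) (t n) (m n) (b n))
              (haarAverage (Fin n → Bool) (t n)) ≤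
            C * ((t n : ℝ) * (m n : ℝ) * (b n) ^ 2 / (2 : ℝ) ^ n) +
              C * ((t n : ℝ) ^ 2 / (m n : ℝ))) ∧
    -- the interpolation: `b = ±1` gives subset states, `b = 0` unbiased subset-phase states
    (∀ n t m : ℕ,
      biasedSubsetPhaseAverage (Fin n → Bool) t m 1 = subsetStateAverage (Fin n → Bool) t m ∧
      biasedSubsetPhaseAverage (Fin n → Bool) t m (-1) =
        subsetStateAverage (Fin n → Bool) t m ∧
      biasedSubsetPhaseAverage (Fin n → Bool) t m 0 =
        uniformSubsetPhaseAverage (Fin n → Bool) t m) := by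
  refine ⟨⟨3, by norm_num, fun t m b _ hm hmN hb => ?_⟩, fun n t m => ⟨?_, ?_, ?_⟩⟩
  -- Exponent `k = 0` of the growth hypothesis gives 1 ≤ m eventually; the comparison with 2^n then
  -- supplies m ≤ N, and the bound holds for each such n.
  · have hpos : ∀ᶠ n : ℕ in atTop, 0 < m n := by
      filter_upwards [(hm 0).bound one_pos] with n hn
      rcases Nat.eq_zero_or_pos (m n) with h | h
      · norm_num [h] at hn
      · exact h
    filter_upwards [hpos, hmN.bound one_pos] with n hn hle
    have hcard : (Fintype.card (Fin n → Bool) : ℝ) = 2 ^ n := by simp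
    have hle' : m n ≤ Fintype.card (Fin n → Bool) := by
      rw [one_mul, Real.norm_of_nonneg (by positivity), Real.norm_of_nonneg (by positivity),
        ← hcard] at hle
      exact_mod_cast hle
    have h := traceDistance_biasedSubsetPhaseAverage_le hn hle' (hb n) (t n)
    rwa [hcard] at h
  · exact biasedSubsetPhaseAverage_of_deterministic t m true fun s => by
      cases s <;> norm_num [bitWeight]
  · exact biasedSubsetPhaseAverage_of_deterministic t m false fun s => by
      cases s <;> norm_num [bitWeight]
  · exact biasedSubsetPhaseAverage_zero t m
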